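/- Let $\mathbb D$ be the open unit disk, let $z_1,\dots,z_k\in\mathbb D$ be distinct points, $n_1,\dots,n_k$ nonnegative integers, and $f_{i,j}$ ($1\le i\le k$, $0\le j\le n_i-1$) arbitrary complex numbers. Let $T$ be the block diagonal matrix with diagonal blocks $J_{n_i}(z_i)$, where $J_n(z)$ is the $n\times n$ lower triangular Jordan block ($z$ on the diagonal, ones on the first subdiagonal, zeros elsewhere). Let $E$ be the column vector whose $i$-th block is $(1,0,\dots,0)^{\top}\in\mathbb C^{n_i}$, and $C$ the column vector whose $i$-th block is $(f_{i,0},\dots,f_{i,n_i-1})^{\top}$. Let $$P=\sum_{j=0}^{\infty}T^{j}(EE^*-CC^*)T^{*j}$$ be the Pick matrix, a Hermitian matrix, and let $\mathrm{sq}_+(P)$ and $\mathrm{sq}_-(P)$ be the numbers of its positive and negative eigenvalues, counted with multiplicity. Assume that $P$ is invertible and put $$\Theta(z)=\begin{bmatrix}\Theta_{11}(z)&\Theta_{12}(z)\\ \Theta_{21}(z)&\Theta_{22}(z)\end{bmatrix}=I_2+(z-1)\begin{bmatrix}E^*\\ C^*\end{bmatrix}(I-zT^*)^{-1}P^{-1}(I-T)^{-1}\begin{bmatrix}E&-C\end{bmatrix}.$$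 Let $\tilde\kappa\ge 0$ be an integer, $S$ a Schur function (analytic on $\mathbb D$ with $|S|\le 1$ there), $B$ a finite Blaschke product of degree $\tilde\kappa$ (for degree $0$, a unimodular constant), and set $$U=\Theta_{11}S+\Theta_{12}B,\qquad V=\Theta_{21}S+\Theta_{22}B .$$ Zeros are counted with multiplicity, and a function that vanishes identically near a point has a zero of infinite multiplicity there. Then: 1. $V$ has exactly $\mathrm{sq}_-(P)+\tilde\kappa$ zeros in $\mathbb D$. If, in addition, $S$ is a finite Blaschke product of degree $m$, then $U$ has exactly $\mathrm{sq}_+(P)+m$ zeros in $\mathbb D$. 2. If $S$ and $B$ have no common zero in $\mathbb D$, then every common zero of $U$ and $V$ in $\mathbb D$ is one of the points $z_1,\dots,z_k$. 3. If $S$ and $B$ have no common zero in $\mathbb D$, then for every $j$ the smaller of the multiplicities of $z_j$ as a zero of $U$ and of $V$ is at most $n_j$. 4. If $S$ and $B$ have no common zero in $\mathbb D$ and $V$ has a zero of multiplicity $m_j>n_j$ at $z_j$, then $U$ has a zero of multiplicity exactly $n_j$ at $z_j$. 5. If $V$ has a zero of multiplicity $m_j\le n_j$ at $z_j$ (where $m_j=0$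 means $V(z_j)\ne 0$), then $U$ has a zero of multiplicity at least $m_j$ at $z_j$. -/

import Mathlib

namespace MultiPoint

open Metric Matrix

/-- The Schur class: analytic functions mapping the open unit disk into the closed unit disk. -/
def IsSchur (S : ℂ → ℂ) : Prop :=
  AnalyticOnNhd ℂ S (ball 0 1) ∧ Set.MapsTo S (ball 0 1) (closedBall 0 1)

/-- `B` is, on the open unit disk, a finite Blaschke product of degree `m`
(a unimodular constant if `m = 0`). -/
def IsBlaschke (m : ℕ) (B : ℂ → ℂ) : Prop :=
  ∃ (c : ℂ) (a : Fin m → ℂ), ‖c‖ = 1 ∧ (∀ i, a i ∈ ball (0 : ℂ) 1) ∧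
    ∀ z ∈ ball (0 : ℂ) 1, B z = c * ∏ i, (z - a i) / (1 - star (a i) * z)

/-- The total number of zeros of `g` in the open unit disk, counted with multiplicity:
the supremum of the partial sums, over finite subsets of the disk, of the orders of vanishing.
It is `⊤` if there are infinitely many zeros or a zero of infinite order. -/
noncomputable def numZeros (g : ℂ → ℂ) : ℕ∞ :=
  ⨆ (F : Finset ℂ) (_ : (F : Set ℂ) ⊆ ball 0 1), ∑ w ∈ F, analyticOrderAt g w

/-- The number of negative eigenvalues of a (Hermitian) matrix, with multiplicity. -/
noncomputable def sqNeg {ι : Type*} [Fintype ι] [DecidableEq ι] (A : Matrix ι ι ℂ) : ℕ := by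
  classical
  exact A.charpoly.roots.countP (fun μ => μ.im = 0 ∧ μ.re < 0)

/-- The number of positive eigenvalues of a (Hermitian) matrix, with multiplicity. -/
noncomputable def sqPos {ι : Type*} [Fintype ι] [DecidableEq ι] (A : Matrix ι ι ℂ) : ℕ := by
  classical
  exact A.charpoly.roots.countP (fun μ => μ.im = 0 ∧ 0 < μ.re)

/-- The lower triangular Jordan block of size `n`: `z` on the diagonal, ones just below it. -/
def jordanBlock (n : ℕ) (z : ℂ) : Matrix (Fin n) (Fin n) ℂ :=
  Matrix.of fun a b => if a = b then z else if (a : ℕ) = (b : ℕ) + 1 then 1 else 0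

variable {k : ℕ}

/-- The block diagonal matrix `T` with the blocks `J_{n_i}(z_i)`. -/
def matT (n : Fin k → ℕ) (z : Fin k → ℂ) :
    Matrix (Σ i, Fin (n i)) (Σ i, Fin (n i)) ℂ :=
  Matrix.blockDiagonal' fun i => jordanBlock (n i) (z i)

/-- The column `E`: the first entry of each block is one, the others vanish. -/
def vecE (n : Fin k → ℕ) : (Σ i, Fin (n i)) → ℂ :=
  fun p => if (p.2 : ℕ) = 0 then 1 else 0

/-- The column `C` of the interpolation values `f_{i,j}`. -/
def vecC (n : Fin k → ℕ) (f : ∀ i, Fin (n i) → ℂ) : (Σ i, Fin (n i)) → ℂ :=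
  fun p => f p.1 p.2

/-- The Pick matrix `P = ∑ T^j (E E^* - C C^*) T^{*j}`. -/
noncomputable def pickMatrix (n : Fin k → ℕ) (z : Fin k → ℂ) (f : ∀ i, Fin (n i) → ℂ) :
    Matrix (Σ i, Fin (n i)) (Σ i, Fin (n i)) ℂ :=
  ∑' j : ℕ, matT n z ^ j *
    (vecMulVec (vecE n) (star (vecE n)) - vecMulVec (vecC n f) (star (vecC n f))) *
      (matT n z)ᴴ ^ j

/-- The two-column matrix `[E  C]`. -/
def colsEC (n : Fin k → ℕ) (f : ∀ i, Fin (n i) → ℂ) : Matrix (Σ i, Fin (n i)) (Fin 2) ℂ :=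
  Matrix.of fun p => ![vecE n p, vecC n f p]

/-- The two-column matrix `[E  -C]`. -/
def colsENegC (n : Fin k → ℕ) (f : ∀ i, Fin (n i) → ℂ) : Matrix (Σ i, Fin (n i)) (Fin 2) ℂ :=
  Matrix.of fun p => ![vecE n p, -vecC n f p]

/-- `Θ(w) = I + (w - 1) [E C]^* (I - w T^*)⁻¹ P⁻¹ (I - T)⁻¹ [E -C]`. -/
noncomputable def Theta (n : Fin k → ℕ) (z : Fin k → ℂ) (f : ∀ i, Fin (n i) → ℂ) (w : ℂ) :
    Matrix (Fin 2) (Fin 2) ℂ :=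
  1 + (w - 1) • ((colsEC n f)ᴴ * (1 - w • (matT n z)ᴴ)⁻¹ * (pickMatrix n z f)⁻¹ *
    (1 - matT n z)⁻¹ * colsENegC n f)

/-- The numerator `U = Θ₁₁ S + Θ₁₂ B`. -/
noncomputable def numU (n : Fin k → ℕ) (z : Fin k → ℂ) (f : ∀ i, Fin (n i) → ℂ)
    (S B : ℂ → ℂ) (w : ℂ) : ℂ :=
  Theta n z f w 0 0 * S w + Theta n z f w 0 1 * B w

/-- The denominator `V = Θ₂₁ S + Θ₂₂ B`. -/
noncomputable def denV (n : Fin k → ℕ) (z : Fin k → ℂ) (f : ∀ i, Fin (n i) → ℂ)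
    (S B : ℂ → ℂ) (w : ℂ) : ℂ :=
  Theta n z f w 1 0 * S w + Theta n z f w 1 1 * B w

end MultiPoint

/-!
Write `T`, `P`, `E`, `C` for the data. The defining series shows that `P` solves the Stein equation
`P - T P T^* = E E^* - C C^*` (`isSteinData_pickMatrix`), and everything except the interpolation
property uses only this equation, the invertibility of `P` and the fact that the spectrum of `T`
lies in the disk (`IsSteinData`).

*Zero counts.* On the unit circle `Θ J Θ^* = J` with `J = diag(1, -1)`, so
`|Θ₂₂|² = 1 + |Θ₂₁|²` (`IsSteinData.normSq_thetaMat`). Hence `Θ₂₂ B` dominates `Θ₂₁ S` near the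
circle, and by Rouché's theorem (`numZeros_eq_card`) `V` has as many zeros in the disk as `Θ₂₂ B`.
The zeros of `Θ₂₂` are counted with linear algebra. By the matrix determinant lemma
`Θ₂₂(w)` is, up to a zero-free factor, `det ((1 - w) Z + (1 + w))` for the matrix `Z = lyapMat`
(`IsSteinData.thetaMat_one_one_mul`), so the zeros in the disk are the Cayley transforms of the
eigenvalues of `Z` in the left half-plane. The Stein equation turns into
`P Z + Z^* P = 2 (I - T)⁻¹ (E E^* + C C^*) (I - T^*)⁻¹ ≥ 0`, and the inertia theorem
(`countP_eq_sqNeg`) says that there are `sqNeg P` such eigenvalues. The count for `U` follows from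
the one for `V`, because exchanging `E` with `C` and `P` with `-P` exchanges the rows and columns
of `Θ`.

*Common zeros.* The same algebra gives `det Θ` as a zero-free function times
`∏ (w - z i) ^ n i` (`det_thetaMat_eq`). By Cramer's rule `(det Θ) S` and `(det Θ) B` are
combinations of `U` and `V`, which bounds the common zeros. Finally `[E -C] Θ(w)` is `w - T` times
a function holomorphic in the disk (`IsSteinData.cols_mul_thetaMat`). Read off in the last row of
the block `j`, this says `U ≡ F V` modulo `(w - z j) ^ n j`, where `F` is the Taylor polynomial of
the data (`min_le_analyticOrderAt`); the last two statements about multiplicities follow.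
-/

namespace MultiPoint

open Metric Matrix Filter Topology
open scoped ComplexOrder

/-! ### Counting zeros by the argument principle -/

/-- A zero of finite order `n` can be divided out on all of an open set. -/
lemma exists_eq_pow_mul {U : Set ℂ} (hU : IsOpen U) {w : ℂ} (hw : w ∈ U) (n : ℕ) :
    ∀ f : ℂ → ℂ, DifferentiableOn ℂ f U → analyticOrderAt f w = n →
      ∃ h : ℂ → ℂ, DifferentiableOn ℂ h U ∧ (∀ z, f z = (z - w) ^ n * h z) ∧ h w ≠ 0 := by
  induction n with
  | zero =>
    intro f hf h0
    refine ⟨f, hf, by simp, ?_⟩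
    exact ((hf.analyticAt (hU.mem_nhds hw)).analyticOrderAt_eq_zero).1 (by simpa using h0)
  | succ n ih =>
    intro f hf hn
    have hfw : f w = 0 := apply_eq_zero_of_analyticOrderAt_ne_zero (by rw [hn]; simp)
    have hd : DifferentiableOn ℂ (dslope f w) U :=
      (Complex.differentiableOn_dslope (hU.mem_nhds hw)).2 hf
    have hfd : ∀ z, f z = (z - w) * dslope f w z := fun z => by
      have := sub_smul_dslope f w z
      simp [hfw] at this
      exact this.symm
    have hord : analyticOrderAt (dslope f w) w = n := by
      have h1 : f = (fun z => z - w) * dslope f w := funext hfd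
      have h2 : analyticOrderAt (fun z : ℂ => z - w) w = 1 := by
        simpa [-analyticOrderAt_id_sub_const_self] using
          analyticOrderAt_centeredMonomial (𝕜 := ℂ) (z₀ := w) (n := 1)
      rw [h1, analyticOrderAt_mul (by fun_prop) (hd.analyticAt (hU.mem_nhds hw)), h2, Nat.cast_add,
        Nat.cast_one, add_comm] at hn
      exact ENat.add_left_injective_of_ne_top (by simp) hn
    obtain ⟨h, hh, hfac, hne⟩ := ih _ hd hord
    exact ⟨h, hh, fun z => by rw [hfd, hfac, pow_succ]; ring, hne⟩

lemma differentiable_multiset_prod (s : Multiset ℂ) :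
    Differentiable ℂ (fun z : ℂ => (s.map fun a => z - a).prod) := by
  induction s using Multiset.induction_on with
  | empty => simp
  | cons a s ih =>
    simp only [Multiset.map_cons, Multiset.prod_cons]
    fun_prop

lemma multiset_prod_ne_zero {s : Multiset ℂ} {z : ℂ} (h : z ∉ s) :
    (s.map fun a => z - a).prod ≠ 0 := by
  intro h0
  obtain ⟨a, ha, h'⟩ := Multiset.mem_map.1 (Multiset.prod_eq_zero_iff.1 h0)
  exact h (by rwa [sub_eq_zero.1 h'])

/-- Finitely many zeros can be divided out; the monic factor is recorded by the multiset of
its roots. -/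
lemma exists_eq_prod_mul {U : Set ℂ} (hU : IsOpen U) {f : ℂ → ℂ} (hf : DifferentiableOn ℂ f U)
    (F : Finset ℂ) : (∀ w ∈ F, w ∈ U) → (∀ w ∈ F, analyticOrderAt f w ≠ ⊤) →
    ∃ (s : Multiset ℂ) (g : ℂ → ℂ), (∀ a ∈ s, a ∈ F) ∧
      ((s.card : ℕ) : ℕ∞) = ∑ w ∈ F, analyticOrderAt f w ∧ DifferentiableOn ℂ g U ∧
      (∀ z, f z = (s.map fun a => z - a).prod * g z) ∧ ∀ w ∈ F, g w ≠ 0 := by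
  classical
  induction F using Finset.induction_on with
  | empty => exact fun _ _ => ⟨0, f, by simp, by simp, hf, by simp, by simp⟩
  | insert w F hwF ih =>
    intro hFU hord
    obtain ⟨s, g, hs, hcard, hg, hfac, hne⟩ := ih (fun v hv => hFU v (by simp [hv]))
      (fun v hv => hord v (by simp [hv]))
    have hw : w ∈ U := hFU w (by simp)
    have hp := differentiable_multiset_prod s
    have hpw : (s.map fun a => w - a).prod ≠ 0 := multiset_prod_ne_zero fun h => hwF (hs w h)
    have hofg : analyticOrderAt f w = analyticOrderAt g w := by
      have h1 : f = (fun z : ℂ => (s.map fun a => z - a).prod) * g := funext hfac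
      rw [h1, analyticOrderAt_mul (hp.analyticAt w) (hg.analyticAt (hU.mem_nhds hw)),
        ((hp.analyticAt w).analyticOrderAt_eq_zero).2 hpw, zero_add]
    obtain ⟨n, hn⟩ := ENat.ne_top_iff_exists.1 (hord w (by simp))
    obtain ⟨h, hh, hgh, hhw⟩ := exists_eq_pow_mul hU hw n g hg (by rw [← hofg, hn])
    refine ⟨Multiset.replicate n w + s, h, ?_, ?_, hh, ?_, ?_⟩
    · intro a ha
      rcases Multiset.mem_add.1 ha with ha | ha
      · simp [Multiset.eq_of_mem_replicate ha]
      · simp [hs a ha]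
    · rw [Finset.sum_insert hwF, ← hcard, ← hn]; simp
    · intro z
      rw [hfac, hgh]; simp; ring
    · intro v hv
      rcases Finset.mem_insert.1 hv with rfl | hv
      · exact hhw
      · intro h0
        exact hne v hv (by rw [hgh, h0, mul_zero])

/-- A holomorphic function without zeros on a circle has finitely many zeros inside, all of finite
order: otherwise the zeros accumulate and the identity theorem applies. -/
lemma finite_zeros {U : Set ℂ} (hU : IsOpen U) {r : ℝ} (hr : 0 < r)
    (hrU : closedBall (0 : ℂ) r ⊆ U) {f : ℂ → ℂ} (hf : DifferentiableOn ℂ f U)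
    (hne : ∀ z ∈ sphere (0 : ℂ) r, f z ≠ 0) :
    {z ∈ closedBall (0 : ℂ) r | f z = 0}.Finite ∧
      ∀ z ∈ closedBall (0 : ℂ) r, analyticOrderAt f z ≠ ⊤ := by
  have hA : AnalyticOnNhd ℂ f (closedBall (0 : ℂ) r) :=
    fun z hz => hf.analyticAt (hU.mem_nhds (hrU hz))
  have hpc : IsPreconnected (closedBall (0 : ℂ) r) := (convex_closedBall _ _).isPreconnected
  have hrs : (r : ℂ) ∈ sphere (0 : ℂ) r := by simp [abs_of_pos hr]
  have key : ∀ z ∈ closedBall (0 : ℂ) r, ¬ ∃ᶠ w in 𝓝[≠] z, f w = 0 := fun z hz h =>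
    hne _ hrs (hA.eqOn_zero_of_preconnected_of_frequently_eq_zero hpc hz h
      (sphere_subset_closedBall hrs))
  constructor
  · by_contra hinf
    obtain ⟨z, hz, hacc⟩ := Set.Infinite.exists_accPt_of_subset_isCompact hinf
      (isCompact_closedBall (0 : ℂ) r) (fun z hz => hz.1)
    exact key z hz ((accPt_iff_frequently_nhdsNE.1 hacc).mono fun w hw => hw.2)
  · intro z hz htop
    exact key z hz ((analyticOrderAt_eq_top.1 htop).filter_mono nhdsWithin_le_nhds).frequently

lemma continuousOn_logDeriv {U : Set ℂ} (hU : IsOpen U) {K : Set ℂ} (hKU : K ⊆ U) {f : ℂ → ℂ}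
    (hf : DifferentiableOn ℂ f U) (hne : ∀ z ∈ K, f z ≠ 0) : ContinuousOn (logDeriv f) K := by
  intro z hz
  have h := hf.analyticAt (hU.mem_nhds (hKU hz))
  exact (h.deriv.continuousAt.div h.continuousAt (hne z hz)).continuousWithinAt

/-- The argument principle for a function given as a monic polynomial times a zero-free one. -/
lemma circleIntegral_logDeriv_prod_mul {U : Set ℂ} (hU : IsOpen U) {r : ℝ} (hr : 0 < r)
    (hrU : closedBall (0 : ℂ) r ⊆ U) {g : ℂ → ℂ} (hg : DifferentiableOn ℂ g U)
    (hne : ∀ z ∈ closedBall (0 : ℂ) r, g z ≠ 0) (s : Multiset ℂ) :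
    (∀ a ∈ s, a ∈ ball (0 : ℂ) r) →
    (∮ z in C(0, r), logDeriv (fun z => (s.map fun a => z - a).prod * g z) z) =
      2 * Real.pi * Complex.I * s.card := by
  induction s using Multiset.induction_on with
  | empty =>
    intro _
    simp only [Multiset.map_zero, Multiset.prod_zero, one_mul, Multiset.card_zero, Nat.cast_zero,
      mul_zero]
    refine Complex.circleIntegral_eq_zero_of_differentiable_on_off_countable hr.le
      Set.countable_empty (continuousOn_logDeriv hU hrU hg hne) ?_
    intro z hz
    have hz' := ball_subset_closedBall hz.1
    have h := hg.analyticAt (hU.mem_nhds (hrU hz'))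
    exact h.deriv.differentiableAt.div h.differentiableAt (hne z hz')
  | cons a s ih =>
    intro hs
    have hs' : ∀ b ∈ s, b ∈ ball (0 : ℂ) r := fun b hb => hs b (Multiset.mem_cons_of_mem hb)
    have ha : a ∈ ball (0 : ℂ) r := hs a (Multiset.mem_cons_self a s)
    set F : ℂ → ℂ := fun z => (s.map fun a => z - a).prod * g z with hF
    have hFd : DifferentiableOn ℂ F U := (differentiable_multiset_prod s).differentiableOn.mul hg
    have hsph : ∀ z ∈ sphere (0 : ℂ) r, ∀ b ∈ ball (0 : ℂ) r, z ≠ b := by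
      rintro z hz b hb rfl
      simp only [mem_sphere, mem_ball] at hz hb
      linarith
    have hF0 : ∀ z ∈ sphere (0 : ℂ) r, F z ≠ 0 := fun z hz =>
      mul_ne_zero (multiset_prod_ne_zero fun h => hsph z hz z (hs' z h) rfl)
        (hne z (sphere_subset_closedBall hz))
    have hcongr : ∀ z ∈ sphere (0 : ℂ) r,
        logDeriv (fun z => ((a ::ₘ s).map fun a => z - a).prod * g z) z =
          (z - a)⁻¹ + logDeriv F z := by
      intro z hz
      have hU' := hU.mem_nhds (hrU (sphere_subset_closedBall hz))
      have h1 : (fun z => ((a ::ₘ s).map fun a => z - a).prod * g z) =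
          fun z => (z - a) * F z := by
        ext z; simp [hF, mul_assoc]
      rw [h1,
        logDeriv_mul (f := fun z => z - a) z (sub_ne_zero.2 (hsph z hz a ha)) (hF0 z hz) (by
          fun_prop)
        (hFd.differentiableAt hU')]
      congr 1
      simp [logDeriv_apply]
    rw [circleIntegral.integral_congr hr.le hcongr, circleIntegral.integral_add, ih hs',
      circleIntegral.integral_sub_inv_of_mem_ball ha]
    · simp; ring
    · refine ContinuousOn.circleIntegrable hr.le ?_
      exact ContinuousOn.inv₀ (by fun_prop) fun z hz => sub_ne_zero.2 (hsph z hz a ha)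
    · exact (continuousOn_logDeriv hU (sphere_subset_closedBall.trans hrU) hFd
        hF0).circleIntegrable hr.le

/-- **Rouché's theorem**, for the integrals of the logarithmic derivatives: the quotient
`1 + g / f` has a holomorphic logarithm near the circle. -/
lemma circleIntegral_logDeriv_add {U : Set ℂ} (hU : IsOpen U) {r : ℝ} (hr : 0 < r)
    (hrU : closedBall (0 : ℂ) r ⊆ U) {f g : ℂ → ℂ} (hf : DifferentiableOn ℂ f U)
    (hg : DifferentiableOn ℂ g U) (hlt : ∀ z ∈ sphere (0 : ℂ) r, ‖g z‖ < ‖f z‖) :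
    (∮ z in C(0, r), logDeriv (fun z => f z + g z) z) = ∮ z in C(0, r), logDeriv f z := by
  have hf0 : ∀ z ∈ sphere (0 : ℂ) r, f z ≠ 0 := fun z hz h0 => by
    have := hlt z hz
    rw [h0, norm_zero] at this
    exact absurd this (norm_nonneg _).not_gt
  have hsU := (sphere_subset_closedBall (x := (0 : ℂ)) (ε := r)).trans hrU
  have hAf : ∀ z ∈ sphere (0 : ℂ) r, AnalyticAt ℂ f z :=
    fun z hz => hf.analyticAt (hU.mem_nhds (hsU hz))
  have hAg : ∀ z ∈ sphere (0 : ℂ) r, AnalyticAt ℂ g z :=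
    fun z hz => hg.analyticAt (hU.mem_nhds (hsU hz))
  set q : ℂ → ℂ := fun z => 1 + g z / f z with hq
  have hAq : ∀ z ∈ sphere (0 : ℂ) r, AnalyticAt ℂ q z := fun z hz =>
    analyticAt_const.add ((hAg z hz).div (hAf z hz) (hf0 z hz))
  have hslit : ∀ z ∈ sphere (0 : ℂ) r, q z ∈ Complex.slitPlane := fun z hz => by
    refine Complex.mem_slitPlane_of_norm_lt_one ?_
    rw [norm_div, div_lt_one (norm_pos_iff.2 (hf0 z hz))]
    exact hlt z hz
  have hq0 : ∀ z ∈ sphere (0 : ℂ) r, q z ≠ 0 := fun z hz =>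
    Complex.slitPlane_ne_zero (hslit z hz)
  have hcq : ContinuousOn (logDeriv q) (sphere (0 : ℂ) r) := fun z hz =>
    ((hAq z hz).deriv.continuousAt.div (hAq z hz).continuousAt (hq0 z hz)).continuousWithinAt
  have hcongr : ∀ z ∈ sphere (0 : ℂ) r,
      logDeriv (fun z => f z + g z) z = logDeriv f z + logDeriv q z := by
    intro z hz
    have h1 : (fun z => f z + g z) =ᶠ[𝓝 z] fun z => f z * q z := by
      filter_upwards [(hAf z hz).continuousAt.eventually_ne (hf0 z hz)] with w hw
      simp only [hq]
      field_simp
    have h2 : logDeriv (fun z => f z + g z) z = logDeriv (fun z => f z * q z) z := by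
      simp only [logDeriv_apply, h1.deriv_eq, h1.eq_of_nhds]
    rw [h2, logDeriv_mul z (hf0 z hz) (hq0 z hz) (hAf z hz).differentiableAt
      (hAq z hz).differentiableAt]
  have hzero : (∮ z in C(0, r), logDeriv q z) = 0 := by
    refine circleIntegral.integral_eq_zero_of_hasDerivWithinAt (f := fun z => Complex.log (q z))
      hr.le fun z hz => ?_
    exact ((hAq z hz).differentiableAt.hasDerivAt.clog (hslit z hz)).hasDerivWithinAt
  rw [circleIntegral.integral_congr hr.le hcongr, circleIntegral.integral_add, hzero, add_zero]
  · exact (continuousOn_logDeriv hU hsU hf hf0).circleIntegrable hr.le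
  · exact hcq.circleIntegrable hr.le

/-- If, near the unit circle, `V` is dominated by a term with the zeros `s` in the disk and no
others, then `V` has as many zeros in the disk as `s` has elements. -/
theorem numZeros_eq_card {s : Multiset ℂ} {h g V : ℂ → ℂ} (hs : ∀ a ∈ s, a ∈ ball (0 : ℂ) 1)
    (hh : DifferentiableOn ℂ h (ball 0 1)) (hh0 : ∀ z ∈ ball (0 : ℂ) 1, h z ≠ 0)
    (hg : DifferentiableOn ℂ g (ball 0 1))
    (hV : ∀ z ∈ ball (0 : ℂ) 1, V z = (s.map fun a => z - a).prod * h z + g z)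
    (hlt : ∃ r₀ < (1 : ℝ), ∀ z : ℂ, r₀ < ‖z‖ → ‖z‖ < 1 →
      ‖g z‖ < ‖(s.map fun a => z - a).prod * h z‖) :
    numZeros V = (s.card : ℕ∞) := by
  classical
  obtain ⟨r₀, hr₀, hlt⟩ := hlt
  set p : ℂ → ℂ := fun z => (s.map fun a => z - a).prod * h z with hp
  have hpd : DifferentiableOn ℂ p (ball 0 1) :=
    (differentiable_multiset_prod s).differentiableOn.mul hh
  have hVd : DifferentiableOn ℂ V (ball 0 1) := (hpd.add hg).congr hV
  -- on every disk of radius close to one, the zeros form a finite set of the right total order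
  have key : ∀ r : ℝ, r < 1 → 0 < r → r₀ < r → (∀ a ∈ s, a ∈ ball (0 : ℂ) r) →
      ∃ Z : Finset ℂ, (Z : Set ℂ) ⊆ ball 0 1 ∧ (∀ w ∈ closedBall (0 : ℂ) r, V w = 0 → w ∈ Z) ∧
        ∑ w ∈ Z, analyticOrderAt V w = (s.card : ℕ∞) := by
    intro r hr1 hr hr0r hsr
    have hrU : closedBall (0 : ℂ) r ⊆ ball 0 1 := closedBall_subset_ball hr1
    have hsph : ∀ z ∈ sphere (0 : ℂ) r, ‖g z‖ < ‖p z‖ := fun z hz => by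
      have : ‖z‖ = r := by simpa using hz
      exact hlt z (by linarith) (by linarith)
    have hVne : ∀ z ∈ sphere (0 : ℂ) r, V z ≠ 0 := fun z hz h0 => by
      have h1 := hV z (hrU (sphere_subset_closedBall hz))
      rw [h0] at h1
      have h2 : g z = - p z := by simp only [hp]; linear_combination -h1
      have h3 := hsph z hz
      rw [h2, norm_neg] at h3
      exact lt_irrefl _ h3
    obtain ⟨hfin, htop⟩ := finite_zeros isOpen_ball hr hrU hVd hVne
    have hmem : ∀ w, w ∈ hfin.toFinset ↔ w ∈ closedBall (0 : ℂ) r ∧ V w = 0 := fun w => by simp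
    obtain ⟨t, G, ht, hcard, hG, hfac, hGne⟩ := exists_eq_prod_mul isOpen_ball hVd hfin.toFinset
      (fun w hw => hrU ((hmem w).1 hw).1) (fun w hw => htop w ((hmem w).1 hw).1)
    have htb : ∀ a ∈ t, a ∈ ball (0 : ℂ) r := fun a ha => by
      have h1 := (hmem a).1 (ht a ha)
      have h2 : a ∉ sphere (0 : ℂ) r := fun h => hVne a h h1.2
      have h3 : ‖a‖ ≤ r := by simpa using h1.1
      have h4 : ‖a‖ ≠ r := by simpa using h2
      simpa using lt_of_le_of_ne h3 h4
    have hG0 : ∀ z ∈ closedBall (0 : ℂ) r, G z ≠ 0 := fun z hz h0 =>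
      hGne z ((hmem z).2 ⟨hz, by rw [hfac, h0, mul_zero]⟩) h0
    have hI1 := circleIntegral_logDeriv_prod_mul isOpen_ball hr hrU hG hG0 t htb
    have hI2 := circleIntegral_logDeriv_prod_mul isOpen_ball hr hrU hh
      (fun z hz => hh0 z (hrU hz)) s hsr
    have hI3 := circleIntegral_logDeriv_add isOpen_ball hr hrU hpd hg hsph
    rw [hI2] at hI3
    have hI4 : (∮ z in C(0, r), logDeriv (fun z => p z + g z) z) =
        ∮ z in C(0, r), logDeriv (fun z => (t.map fun a => z - a).prod * G z) z := by
      refine circleIntegral.integral_congr hr.le fun z hz => ?_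
      have h1 : (fun z => p z + g z) =ᶠ[𝓝 z] fun z => (t.map fun a => z - a).prod * G z := by
        filter_upwards [isOpen_ball.mem_nhds (hrU (sphere_subset_closedBall hz))] with w hw
        rw [← hfac, hV w hw]
      simp only [logDeriv_apply, h1.deriv_eq, h1.eq_of_nhds]
    rw [hI4, hI1] at hI3
    have hts : t.card = s.card := by
      have h2 : (2 * Real.pi * Complex.I : ℂ) ≠ 0 := Complex.two_pi_I_ne_zero
      exact_mod_cast mul_left_cancel₀ h2 hI3
    refine ⟨hfin.toFinset, fun w hw => hrU ((hmem w).1 hw).1,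
      fun w hw h0 => (hmem w).2 ⟨hw, h0⟩, ?_⟩
    rw [← hcard, hts]
  -- a radius for a given finite subset of the disk
  have hrad : ∀ F : Finset ℂ, (F : Set ℂ) ⊆ ball 0 1 → ∃ r : ℝ, r < 1 ∧ 0 < r ∧ r₀ < r ∧
      (∀ a ∈ s, a ∈ ball (0 : ℂ) r) ∧ ∀ w ∈ F, w ∈ ball (0 : ℂ) r := by
    intro F hF
    have h1 : ∀ᶠ r in 𝓝[<] (1 : ℝ), ∀ w ∈ F ∪ s.toFinset, ‖w‖ < r := by
      rw [Filter.eventually_all_finset]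
      intro w hw
      have hw1 : ‖w‖ < 1 := by
        rcases Finset.mem_union.1 hw with hw | hw
        · simpa using hF hw
        · simpa using hs w (Multiset.mem_toFinset.1 hw)
      exact (eventually_gt_nhds hw1).filter_mono nhdsWithin_le_nhds
    have h2 : ∀ᶠ r in 𝓝[<] (1 : ℝ), 0 < r ∧ r₀ < r :=
      ((eventually_gt_nhds one_pos).and (eventually_gt_nhds hr₀)).filter_mono nhdsWithin_le_nhds
    obtain ⟨r, ⟨hr1, hr2⟩, hr3⟩ := ((h1.and h2).and self_mem_nhdsWithin).exists
    exact ⟨r, hr3, hr2.1, hr2.2, fun a ha => by simpa using hr1 a (by simp [ha]),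
      fun w hw => by simpa using hr1 w (by simp [hw])⟩
  apply le_antisymm
  · refine iSup₂_le fun F hF => ?_
    obtain ⟨r, hr1, hr, hr0r, hsr, hFr⟩ := hrad F hF
    obtain ⟨Z, -, hZ, hsum⟩ := key r hr1 hr hr0r hsr
    rw [← hsum]
    refine Finset.sum_le_sum_of_ne_zero fun w hw h0 => ?_
    exact hZ w (ball_subset_closedBall (hFr w hw)) (apply_eq_zero_of_analyticOrderAt_ne_zero h0)
  · obtain ⟨r, hr1, hr, hr0r, hsr, -⟩ := hrad ∅ (by simp)
    obtain ⟨Z, hZ1, -, hsum⟩ := key r hr1 hr hr0r hsr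
    rw [← hsum]
    exact le_iSup₂ (f := fun (F : Finset ℂ) (_ : (F : Set ℂ) ⊆ ball 0 1) =>
      ∑ w ∈ F, analyticOrderAt V w) Z hZ1

/-! ### Inertia of Hermitian matrices -/

section

variable {ι : Type*} [Fintype ι] [DecidableEq ι]

lemma sqNeg_eq_card {A : Matrix ι ι ℂ} (hA : A.IsHermitian) :
    sqNeg A = Fintype.card {i // hA.eigenvalues i < 0} := by
  classical
  rw [sqNeg, hA.roots_charpoly_eq_eigenvalues, Multiset.countP_map, Fintype.card_subtype]
  simp [Finset.card_def]

lemma sqPos_eq_card {A : Matrix ι ι ℂ} (hA : A.IsHermitian) :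
    sqPos A = Fintype.card {i // 0 < hA.eigenvalues i} := by
  classical
  rw [sqPos, hA.roots_charpoly_eq_eigenvalues, Multiset.countP_map, Fintype.card_subtype]
  simp [Finset.card_def]

lemma roots_charpoly_neg {A : Matrix ι ι ℂ} (hA : A.IsHermitian) :
    (-A).charpoly.roots = A.charpoly.roots.map Neg.neg := by
  have h : (-A).charpoly = (diagonal fun i => -(hA.eigenvalues i : ℂ)).charpoly := by
    conv_lhs => rw [hA.spectral_theorem, Unitary.conjStarAlgAut_apply, ← neg_mul, ← mul_neg,
      Matrix.charpoly_mul_comm, ← mul_assoc]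
    simp [Matrix.diagonal_neg, Function.comp_def]
  rw [h, charpoly_diagonal, hA.roots_charpoly_eq_eigenvalues, Polynomial.roots_prod]
  · simp [Multiset.bind_singleton]
  · exact Finset.prod_ne_zero_iff.2 fun i _ => Polynomial.X_sub_C_ne_zero _

lemma sqNeg_neg {A : Matrix ι ι ℂ} (hA : A.IsHermitian) : sqNeg (-A) = sqPos A := by
  classical
  rw [sqNeg, sqPos, roots_charpoly_neg hA, Multiset.countP_map, Multiset.countP_eq_card_filter]
  congr 1
  apply Multiset.filter_congr
  intro x _
  simp

lemma eigenvalues_ne_zero {A : Matrix ι ι ℂ} (hA : A.IsHermitian) (hU : IsUnit A) (i : ι) :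
    hA.eigenvalues i ≠ 0 := by
  intro h
  have h1 := hA.det_eq_prod_eigenvalues
  rw [Finset.prod_eq_zero (Finset.mem_univ i) (by simp [h])] at h1
  exact ((Matrix.isUnit_iff_isUnit_det A).1 hU).ne_zero h1

lemma sqNeg_add_sqPos {A : Matrix ι ι ℂ} (hA : A.IsHermitian) (hU : IsUnit A) :
    sqNeg A + sqPos A = Fintype.card ι := by
  classical
  rw [sqNeg_eq_card hA, sqPos_eq_card hA, ← Fintype.card_subtype_or_disjoint]
  · rw [← Fintype.card_subtype_true (α := ι)]
    exact Fintype.card_congr (Equiv.subtypeEquivRight fun i => by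
      simpa using lt_or_gt_of_ne (eigenvalues_ne_zero hA hU i))
  · rw [Pi.disjoint_iff]
    intro i
    simp only [Prop.disjoint_iff, not_and]
    exact fun h => not_lt_of_gt h

/-- The Hermitian form `x ↦ x^* A x`, in the coordinates of an orthonormal eigenbasis. -/
lemma re_form_eq {A : Matrix ι ι ℂ} (hA : A.IsHermitian) (x : ι → ℂ) :
    (star x ⬝ᵥ A *ᵥ x).re = ∑ i, hA.eigenvalues i *
      ‖(star (hA.eigenvectorUnitary : Matrix ι ι ℂ) *ᵥ x) i‖ ^ 2 := by
  set V : Matrix ι ι ℂ := ↑hA.eigenvectorUnitary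
  have h : A = V * diagonal (fun i => (hA.eigenvalues i : ℂ)) * star V := by
    conv_lhs => rw [hA.spectral_theorem, Unitary.conjStarAlgAut_apply]
    rfl
  conv_lhs => rw [h]
  rw [← mulVec_mulVec, ← mulVec_mulVec, dotProduct_mulVec]
  have h2 : star x ᵥ* V = star (star V *ᵥ x) := by
    rw [star_mulVec, star_eq_conjTranspose, conjTranspose_conjTranspose]
  rw [h2, dotProduct, Complex.re_sum]
  refine Finset.sum_congr rfl fun i _ => ?_
  rw [mulVec_diagonal, Pi.star_apply, mul_left_comm, Complex.star_def,
    ← Complex.normSq_eq_conj_mul_self,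
    Complex.normSq_eq_norm_sq, ← Complex.ofReal_mul, Complex.ofReal_re]

/-- A subspace on which the form of `A` is nonpositive has dimension at most `sqNeg A`. -/
lemma finrank_le_sqNeg {A : Matrix ι ι ℂ} (hA : A.IsHermitian) (hU : IsUnit A)
    (N : Submodule ℂ (ι → ℂ)) (hN : ∀ x ∈ N, (star x ⬝ᵥ A *ᵥ x).re ≤ 0) :
    Module.finrank ℂ N ≤ sqNeg A := by
  classical
  set V : Matrix ι ι ℂ := ↑hA.eigenvectorUnitary with hV
  let φ : N →ₗ[ℂ] ({i // hA.eigenvalues i < 0} → ℂ) :=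
    (LinearMap.funLeft ℂ ℂ Subtype.val) ∘ₗ (star V).mulVecLin ∘ₗ N.subtype
  have hφ : Function.Injective φ := by
    rw [← LinearMap.ker_eq_bot, LinearMap.ker_eq_bot']
    rintro ⟨x, hx⟩ h0
    have h1 : ∀ i, hA.eigenvalues i < 0 → (star V *ᵥ x) i = 0 := fun i hi => congrFun h0 ⟨i, hi⟩
    have h2 := hN x hx
    rw [re_form_eq hA] at h2
    have h3 : ∀ i ∈ Finset.univ, 0 ≤ hA.eigenvalues i * ‖(star V *ᵥ x) i‖ ^ 2 := by
      intro i _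
      rcases lt_or_ge (hA.eigenvalues i) 0 with hi | hi
      · rw [h1 i hi]; simp
      · positivity
    have h4 := (Finset.sum_eq_zero_iff_of_nonneg h3).1 (le_antisymm h2 (Finset.sum_nonneg h3))
    have h5 : star V *ᵥ x = 0 := by
      ext i
      have := h4 i (Finset.mem_univ i)
      simpa [eigenvalues_ne_zero hA hU i] using this
    have h6 : x = V *ᵥ (star V *ᵥ x) := by
      rw [mulVec_mulVec, hV, (Matrix.mem_unitaryGroup_iff.1 hA.eigenvectorUnitary.2), one_mulVec]
    rw [h5, mulVec_zero] at h6
    exact Subtype.ext h6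
  rw [sqNeg_eq_card hA]
  simpa using LinearMap.finrank_le_finrank_of_injective hφ

lemma tendsto_zero_of_recursion {E : Type*} [NormedAddCommGroup E] [NormedSpace ℂ E] {w : ℂ}
    (hw : ‖w‖ < 1) {y u : ℕ → E} (hy : ∀ j, y (j + 1) = w • y j + u j)
    (hu : Tendsto u atTop (𝓝 0)) : Tendsto y atTop (𝓝 0) := by
  rw [Metric.tendsto_atTop]
  intro ε hε
  have hq : 0 < 1 - ‖w‖ := by linarith
  obtain ⟨J, hJ⟩ := Metric.tendsto_atTop.1 hu (ε / 2 * (1 - ‖w‖)) (by positivity)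
  have h1 : ∀ i, ‖y (J + i)‖ ≤ ‖w‖ ^ i * ‖y J‖ + ε / 2 := by
    intro i
    induction i with
    | zero => simp; positivity
    | succ i ih =>
      have h2 := (hJ (J + i) (by omega)).le
      rw [dist_zero_right] at h2
      calc ‖y (J + (i + 1))‖ = ‖w • y (J + i) + u (J + i)‖ := by rw [← hy]; rfl
        _ ≤ ‖w‖ * ‖y (J + i)‖ + ‖u (J + i)‖ := (norm_add_le _ _).trans (by rw [norm_smul])
        _ ≤ ‖w‖ * (‖w‖ ^ i * ‖y J‖ + ε / 2) + ε / 2 * (1 - ‖w‖) := by gcongr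
        _ = _ := by ring
  have h2 : Tendsto (fun i => ‖w‖ ^ i * ‖y J‖) atTop (𝓝 0) := by
    simpa using (tendsto_pow_atTop_nhds_zero_of_lt_one (norm_nonneg w) hw).mul_const ‖y J‖
  obtain ⟨I, hI⟩ := Metric.tendsto_atTop.1 h2 (ε / 2) (by positivity)
  refine ⟨J + I, fun n hn => ?_⟩
  obtain ⟨i, rfl⟩ := Nat.exists_eq_add_of_le (show J ≤ n by omega)
  have h3 := hI i (by omega)
  rw [dist_zero_right, Real.norm_of_nonneg (by positivity)] at h3
  rw [dist_zero_right]
  linarith [h1 i]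

/-- Powers of a matrix tend to zero on generalized eigenvectors for eigenvalues in the disk. -/
lemma tendsto_pow_mulVec (W : Matrix ι ι ℂ) {w : ℂ} (hw : ‖w‖ < 1) (m : ℕ) :
    ∀ x : ι → ℂ, (W - w • (1 : Matrix ι ι ℂ)) ^ m *ᵥ x = 0 →
      Tendsto (fun j => W ^ j *ᵥ x) atTop (𝓝 0) := by
  induction m with
  | zero => intro x hx; simp at hx; simp [hx]
  | succ m ih =>
    intro x hx
    rw [pow_succ, ← mulVec_mulVec] at hx
    refine tendsto_zero_of_recursion hw (fun j => ?_) (ih _ hx)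
    rw [sub_mulVec, mulVec_sub, mulVec_mulVec, smul_mulVec, one_mulVec, mulVec_smul, ← pow_succ]
    abel

/-- The form of `A` is nonpositive where the powers of `W` tend to zero, if `W` does not
decrease it. -/
lemma re_form_nonpos {A W : Matrix ι ι ℂ} (hW : (Wᴴ * A * W - A).PosSemidef) {x : ι → ℂ}
    (hx : Tendsto (fun j => W ^ j *ᵥ x) atTop (𝓝 0)) : (star x ⬝ᵥ A *ᵥ x).re ≤ 0 := by
  have h1 : ∀ y : ι → ℂ, (star y ⬝ᵥ A *ᵥ y).re ≤ (star (W *ᵥ y) ⬝ᵥ A *ᵥ (W *ᵥ y)).re := by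
    intro y
    have h := hW.re_dotProduct_nonneg y
    rw [sub_mulVec, dotProduct_sub, ← mulVec_mulVec, ← mulVec_mulVec, dotProduct_mulVec,
      ← star_mulVec] at h
    simpa using h
  have h2 : ∀ j, (star x ⬝ᵥ A *ᵥ x).re ≤ (star (W ^ j *ᵥ x) ⬝ᵥ A *ᵥ (W ^ j *ᵥ x)).re := by
    intro j
    induction j with
    | zero => simp
    | succ j ih =>
      refine ih.trans ((h1 _).trans ?_)
      rw [mulVec_mulVec _ W, ← pow_succ']
  have hc : Continuous fun y : ι → ℂ => (star y ⬝ᵥ A *ᵥ y).re := by fun_prop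
  have h3 := (hc.tendsto 0).comp hx
  simp only [mulVec_zero, dotProduct_zero, Complex.zero_re] at h3
  exact ge_of_tendsto' h3 h2

lemma finrank_sup_eq_sum {V : Type*} [AddCommGroup V] [Module ℂ V] [FiniteDimensional ℂ V]
    {p : ℂ → Submodule ℂ V} (hp : iSupIndep p) (s : Finset ℂ) :
    Module.finrank ℂ (s.sup p : Submodule ℂ V) = ∑ μ ∈ s, Module.finrank ℂ (p μ) := by
  classical
  induction s using Finset.induction_on with
  | empty => simp
  | insert a s ha ih =>
    have hd : Disjoint (p a) (s.sup p) :=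
      (hp a).mono_right (Finset.sup_le fun μ hμ => le_iSup₂_of_le μ
        (by rintro rfl; exact ha hμ) le_rfl)
    have h := Submodule.finrank_sup_add_finrank_inf_eq (p a) (s.sup p)
    rw [hd.eq_bot, finrank_bot, add_zero] at h
    rw [Finset.sup_insert, h, ih, Finset.sum_insert ha]

open Classical in
/-- The eigenvalues satisfying `q`, counted with algebraic multiplicity, are at most the dimension
of a subspace containing all their generalized eigenvectors. -/
lemma countP_le_finrank (Z : Matrix ι ι ℂ) (q : ℂ → Prop) (N : Submodule ℂ (ι → ℂ))
    (hN : ∀ μ, q μ → ∀ m : ℕ, ∀ x, (Z - μ • (1 : Matrix ι ι ℂ)) ^ m *ᵥ x = 0 → x ∈ N) :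
    Z.charpoly.roots.countP q ≤ Module.finrank ℂ N := by
  set s := (Z.charpoly.roots.filter q).toFinset
  have h1 : Z.charpoly.roots.countP q =
      ∑ μ ∈ s, Module.finrank ℂ (Module.End.maxGenEigenspace Z.mulVecLin μ) := by
    rw [Multiset.countP_eq_card_filter, ← Multiset.toFinset_sum_count_eq]
    refine Finset.sum_congr rfl fun μ hμ => ?_
    rw [LinearMap.finrank_maxGenEigenspace_eq, Matrix.charpoly_mulVecLin,
      Multiset.count_filter_of_pos (Multiset.mem_filter.1 (Multiset.mem_toFinset.1 hμ)).2,
      Polynomial.count_roots]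
  rw [h1, ← finrank_sup_eq_sum (Module.End.independent_maxGenEigenspace Z.mulVecLin)]
  refine Submodule.finrank_mono (Finset.sup_le fun μ hμ x hx => ?_)
  obtain ⟨m, hm⟩ := (Module.End.mem_maxGenEigenspace _ _ _).1 hx
  refine hN μ (Multiset.mem_filter.1 (Multiset.mem_toFinset.1 hμ)).2 m x ?_
  have h2 : Z.mulVecLin - μ • 1 = (Z - μ • (1 : Matrix ι ι ℂ)).mulVecLin := by
    ext; simp
  rw [h2, ← Matrix.toLin'_apply', ← Matrix.toLin'_pow, Matrix.toLin'_apply] at hm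
  exact hm

open Classical in
/-- Half of the inertia theorem, with the sign of `c` choosing the half-plane. The Cayley
transform `(Z + c) (Z - c)⁻¹` turns the Lyapunov inequality into a Stein inequality. -/
lemma countP_le_sqNeg {A Z : Matrix ι ι ℂ} (hA : A.IsHermitian) (hU : IsUnit A) {c : ℝ}
    (hdet : IsUnit (Z - (c : ℂ) • (1 : Matrix ι ι ℂ)).det)
    (hQ : ((c : ℂ) • (A * Z + Zᴴ * A)).PosSemidef) :
    Z.charpoly.roots.countP (fun μ => c * μ.re < 0) ≤ sqNeg A := by
  set D := Z - (c : ℂ) • (1 : Matrix ι ι ℂ) with hD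
  set W := (Z + (c : ℂ) • (1 : Matrix ι ι ℂ)) * D⁻¹ with hWdef
  have hDD : D * D⁻¹ = 1 := mul_nonsing_inv _ hdet
  have hDD' : D⁻¹ * D = 1 := nonsing_inv_mul _ hdet
  have hZ : Z = D + (c : ℂ) • (1 : Matrix ι ι ℂ) := by rw [hD]; abel
  have hW : (Wᴴ * A * W - A).PosSemidef := by
    have h1 : Wᴴ * A * W - A = (D⁻¹)ᴴ * ((2 : ℂ) • ((c : ℂ) • (A * Z + Zᴴ * A))) * D⁻¹ := by
      have h2 : Wᴴ = (D⁻¹)ᴴ * (Zᴴ + (c : ℂ) • (1 : Matrix ι ι ℂ)) := by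
        rw [hWdef, conjTranspose_mul, conjTranspose_add, conjTranspose_smul]; simp
      have h3 : A = (D⁻¹)ᴴ * (Dᴴ * A * D) * D⁻¹ := by
        have : (D⁻¹)ᴴ * Dᴴ = 1 := by rw [← conjTranspose_mul, hDD, conjTranspose_one]
        calc A = ((D⁻¹)ᴴ * Dᴴ) * A * (D * D⁻¹) := by rw [this, hDD]; simp
          _ = _ := by simp only [mul_assoc]
      have h4 : Dᴴ = Zᴴ - (c : ℂ) • (1 : Matrix ι ι ℂ) := by
        rw [hD, conjTranspose_sub, conjTranspose_smul]; simp
      conv_lhs => rw [h2, hWdef]; arg 2; rw [h3]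
      have h5 : (D⁻¹)ᴴ * (Zᴴ + (c : ℂ) • (1 : Matrix ι ι ℂ)) * A *
          ((Z + (c : ℂ) • (1 : Matrix ι ι ℂ)) * D⁻¹) = (D⁻¹)ᴴ * ((Zᴴ + (c : ℂ) • (1 : Matrix ι ι ℂ))
            * A * (Z + (c : ℂ) • (1 : Matrix ι ι ℂ))) * D⁻¹ := by simp only [mul_assoc]
      rw [h5, ← sub_mul, ← mul_sub, h4, hD]
      congr 2
      simp only [add_mul, mul_add, sub_mul, mul_sub, smul_mul_assoc, mul_smul_comm, one_mul,
        mul_one, smul_add, smul_sub, two_smul]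
      abel
    rw [h1]
    exact (hQ.smul (by norm_num)).conjTranspose_mul_mul_same _
  -- the stable subspace of `W`
  let N : Submodule ℂ (ι → ℂ) :=
    { carrier := {x | Tendsto (fun j => W ^ j *ᵥ x) atTop (𝓝 0)}
      add_mem' := fun {x y} hx hy => by
        simpa [mulVec_add] using Tendsto.add (M := ι → ℂ) hx hy
      zero_mem' := by simp
      smul_mem' := fun a x hx => by
        simpa [mulVec_smul] using Tendsto.const_smul (M := ℂ) (α := ι → ℂ) hx a }
  refine (countP_le_finrank Z (fun μ => c * μ.re < 0) N ?_).trans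
    (finrank_le_sqNeg hA hU N fun x hx => re_form_nonpos hW hx)
  intro μ hμ m x hx
  have hne : μ - c ≠ 0 := by
    intro h
    rw [sub_eq_zero.1 h, Complex.ofReal_re] at hμ
    nlinarith [mul_self_nonneg c]
  refine tendsto_pow_mulVec W (w := (μ + c) / (μ - c)) ?_ m x ?_
  · rw [norm_div, div_lt_one (norm_pos_iff.2 hne), ← sq_lt_sq₀ (norm_nonneg _) (norm_nonneg _),
      Complex.sq_norm, Complex.sq_norm, Complex.normSq_apply, Complex.normSq_apply]
    simp only [Complex.add_re, Complex.sub_re, Complex.add_im, Complex.sub_im, Complex.ofReal_re,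
      Complex.ofReal_im]
    nlinarith
  · have h1 : W - ((μ + c) / (μ - c)) • (1 : Matrix ι ι ℂ) =
        (-(2 * c) / (μ - c)) • (D⁻¹ * (Z - μ • (1 : Matrix ι ι ℂ))) := by
      have h2 : W = 1 + (2 * c : ℂ) • D⁻¹ := by
        rw [hWdef, hZ, add_assoc, ← add_smul, add_mul, hDD, smul_mul_assoc, one_mul, two_mul]
      have h3 : D⁻¹ * (Z - μ • (1 : Matrix ι ι ℂ)) = 1 - (μ - c) • D⁻¹ := by
        rw [hZ, add_sub_assoc, ← sub_smul, mul_add, hDD', mul_smul_comm, mul_one, sub_eq_add_neg 1,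
          ← neg_smul, neg_sub]
      rw [h2, h3, smul_sub, smul_smul]
      have h4 : -(2 * c) / (μ - c) * (μ - c) = -(2 * c : ℂ) := by field_simp
      have h5 : (-(2 * c) / (μ - c) : ℂ) = 1 - (μ + c) / (μ - c) := by field_simp; ring
      rw [h4, h5, sub_smul, one_smul, neg_smul]
      abel
    have hcomm : Commute D⁻¹ (Z - μ • (1 : Matrix ι ι ℂ)) := by
      have h2 : Z - μ • (1 : Matrix ι ι ℂ) = D + (c - μ) • (1 : Matrix ι ι ℂ) := by
        rw [hD, sub_smul]; abel
      rw [h2]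
      refine Commute.add_right ?_ ((Commute.one_right _).smul_right _)
      rw [commute_iff_eq, hDD, hDD']
    rw [h1, smul_pow, hcomm.mul_pow, smul_mulVec, ← mulVec_mulVec, hx, mulVec_zero, smul_zero]

open Classical in
/-- **Inertia theorem** of Carlson, Ostrowski and Schneider: if `A Z + Z^* A ≥ 0` and `Z` has no
eigenvalue on the imaginary axis, the eigenvalues of `Z` in the left half-plane are as many as
the negative eigenvalues of `A`. -/
theorem countP_eq_sqNeg {A Z : Matrix ι ι ℂ} (hA : A.IsHermitian) (hU : IsUnit A)
    (hQ : (A * Z + Zᴴ * A).PosSemidef) (hZ : ∀ μ ∈ Z.charpoly.roots, μ.re ≠ 0) :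
    Z.charpoly.roots.countP (fun μ => μ.re < 0) = sqNeg A := by
  have hex : ∃ c : ℝ, 0 < c ∧ (c : ℂ) ∉ Z.charpoly.roots ∧ ((-c : ℝ) : ℂ) ∉ Z.charpoly.roots := by
    have h1 : {c : ℝ | (c : ℂ) ∈ Z.charpoly.roots ∨ ((-c : ℝ) : ℂ) ∈ Z.charpoly.roots}.Finite := by
      have hf : {μ : ℂ | μ ∈ Z.charpoly.roots}.Finite :=
        (Z.charpoly.roots.toFinset.finite_toSet).subset fun μ hμ => by simpa using hμ
      exact (hf.preimage (f := fun c : ℝ => (c : ℂ)) (Complex.ofReal_injective.injOn)).union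
        (hf.preimage (f := fun c : ℝ => ((-c : ℝ) : ℂ))
          ((Complex.ofReal_injective.comp neg_injective).injOn))
    obtain ⟨c, hc, hc'⟩ := (Set.Ioi_infinite (0 : ℝ)).exists_notMem_finite h1
    exact ⟨c, hc, fun h => hc' (Or.inl h), fun h => hc' (Or.inr h)⟩
  obtain ⟨c, hc, hc1, hc2⟩ := hex
  have hdet : ∀ d : ℝ, (d : ℂ) ∉ Z.charpoly.roots →
      IsUnit (Z - (d : ℂ) • (1 : Matrix ι ι ℂ)).det := by
    intro d hd
    rw [isUnit_iff_ne_zero]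
    intro h0
    apply hd
    rw [Polynomial.mem_roots Z.charpoly_monic.ne_zero, Polynomial.IsRoot, Matrix.eval_charpoly,
      ← neg_sub, det_neg, Matrix.scalar_apply, ← smul_one_eq_diagonal, h0, mul_zero]
  have hm := countP_le_sqNeg (c := c) hA hU (hdet c hc1) (hQ.smul (by exact_mod_cast hc.le))
  have hp := countP_le_sqNeg (A := -A) (c := -c) hA.neg hU.neg (hdet (-c) hc2) (by
    have : ((-c : ℝ) : ℂ) • (-A * Z + Zᴴ * -A) = (c : ℂ) • (A * Z + Zᴴ * A) := by
      simp
    rw [this]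
    exact hQ.smul (by exact_mod_cast hc.le))
  rw [sqNeg_neg hA] at hp
  have e1 : (fun μ : ℂ => c * μ.re < 0) = fun μ => μ.re < 0 := by
    ext μ; constructor <;> intro h <;> nlinarith
  have e2 : (fun μ : ℂ => -c * μ.re < 0) = fun μ => 0 < μ.re := by
    ext μ; constructor <;> intro h <;> nlinarith
  simp only [e1] at hm
  simp only [e2] at hp
  have hsum : Z.charpoly.roots.countP (fun μ => μ.re < 0) +
      Z.charpoly.roots.countP (fun μ => 0 < μ.re) = Fintype.card ι := by
    have h1 : Multiset.card Z.charpoly.roots = Fintype.card ι := by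
      rw [← Matrix.charpoly_natDegree_eq_dim Z]
      exact (Polynomial.splits_iff_card_roots.1 (IsAlgClosed.splits _))
    rw [← h1, Multiset.card_eq_countP_add_countP (fun μ : ℂ => μ.re < 0)]
    congr 1
    refine Multiset.countP_congr rfl fun μ hμ => ?_
    -- no eigenvalue lies on the imaginary axis, so `¬ re < 0` means `0 < re`
    have := hZ μ hμ
    simp only [eq_iff_iff, not_lt]
    exact ⟨fun h => h.le, fun h => lt_of_le_of_ne h this.symm⟩
  have := sqNeg_add_sqPos hA hU
  omega

end

/-! ### The matrix function built from a Stein equation -/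

section

/-- The matrix with the two columns `E` and `C`. -/
def cols {ι : Type*} (E C : ι → ℂ) : Matrix ι (Fin 2) ℂ :=
  Matrix.of fun p => ![E p, C p]

lemma conjTranspose_cols_mul_mul_cols_apply {ι : Type*} [Fintype ι] (A A' B B' : ι → ℂ)
    (M : Matrix ι ι ℂ) (i j : Fin 2) :
    ((cols A A')ᴴ * M * cols B B') i j = star (![A, A'] i) ⬝ᵥ M *ᵥ ![B, B'] j := by
  rw [Matrix.mul_assoc, Matrix.mul_apply]
  refine Finset.sum_congr rfl fun p _ => ?_
  congr 1
  · fin_cases i <;> simp [cols]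
  · rw [Matrix.mul_apply]
    refine Finset.sum_congr rfl fun q _ => ?_
    fin_cases j <;> simp [cols]

/-- The right-hand side of the Stein equation is `[E -C] [E C]^*`. -/
lemma cols_mul_conjTranspose {ι : Type*} (E C : ι → ℂ) :
    cols E (-C) * (cols E C)ᴴ = vecMulVec E (star E) - vecMulVec C (star C) := by
  ext p q
  simp [Matrix.mul_apply, cols, vecMulVec_apply, sub_eq_add_neg]

lemma cols_neg {ι : Type*} (E C : ι → ℂ) : cols E (-C) = cols E C * diagonal
    (![1, -1] : Fin 2 → ℂ) := by
  ext p j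
  rw [mul_diagonal]
  fin_cases j <;> simp [cols]

variable {ι : Type*} [Fintype ι] [DecidableEq ι]

/-- The function `I + (w - 1) [E C]^* (I - w T^*)⁻¹ P⁻¹ (I - T)⁻¹ [E -C]` for arbitrary data. -/
noncomputable def thetaMat (T P : Matrix ι ι ℂ) (E C : ι → ℂ) (w : ℂ) : Matrix (Fin 2) (Fin 2) ℂ :=
  1 + (w - 1) • ((cols E C)ᴴ * (1 - w • Tᴴ)⁻¹ * P⁻¹ * (1 - T)⁻¹ * cols E (-C))

/-- The hypotheses on the data: `P` is an invertible Hermitian solution of the Stein equation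
`P - T P T^* = E E^* - C C^*`, and the spectrum of `T` lies in the open unit disk. The latter is
expressed by the invertibility of `I - w T^*` for all `w` in the closed disk. -/
structure IsSteinData (T P : Matrix ι ι ℂ) (E C : ι → ℂ) : Prop where
  isHermitian : P.IsHermitian
  isUnit_det : IsUnit P.det
  stein : P - T * P * Tᴴ = vecMulVec E (star E) - vecMulVec C (star C)
  isUnit_disk : ∀ w : ℂ, ‖w‖ ≤ 1 → IsUnit (1 - w • Tᴴ).det

/-- Interchanging `E` and `C` changes the sign of `P`. -/
lemma IsSteinData.swap {T P : Matrix ι ι ℂ} {E C : ι → ℂ} (h : IsSteinData T P E C) :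
    IsSteinData T (-P) C E where
  isHermitian := h.isHermitian.neg
  isUnit_det := (isUnit_iff_isUnit_det _).1 ((isUnit_iff_isUnit_det _).2 h.isUnit_det).neg
  stein := by
    have := h.stein
    rw [mul_neg, neg_mul, ← neg_sub (vecMulVec E _), ← this]
    abel
  isUnit_disk := h.isUnit_disk

lemma thetaMat_apply (T P : Matrix ι ι ℂ) (E C : ι → ℂ) (w : ℂ) (i j : Fin 2) :
    thetaMat T P E C w i j = (1 : Matrix (Fin 2) (Fin 2) ℂ) i j + (w - 1) *
      (star (![E, C] i) ⬝ᵥ ((1 - w • Tᴴ)⁻¹ * P⁻¹ * (1 - T)⁻¹) *ᵥ ![E, -C] j) := by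
  rw [thetaMat, Matrix.add_apply, Matrix.smul_apply, smul_eq_mul,
    ← conjTranspose_cols_mul_mul_cols_apply]
  simp only [Matrix.mul_assoc]

lemma inv_neg_of_isUnit {P : Matrix ι ι ℂ} (hP : IsUnit P.det) : (-P)⁻¹ = -P⁻¹ :=
  inv_eq_left_inv (by rw [neg_mul_neg, nonsing_inv_mul _ hP])

lemma thetaMat_swap_one_one {T P : Matrix ι ι ℂ} (hP : IsUnit P.det) (E C : ι → ℂ) (w : ℂ) :
    thetaMat T (-P) C E w 1 1 = thetaMat T P E C w 0 0 := by
  simp [thetaMat_apply, inv_neg_of_isUnit hP, neg_mulVec, mulVec_neg]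

lemma thetaMat_swap_one_zero {T P : Matrix ι ι ℂ} (hP : IsUnit P.det) (E C : ι → ℂ) (w : ℂ) :
    thetaMat T (-P) C E w 1 0 = thetaMat T P E C w 0 1 := by
  simp [thetaMat_apply, inv_neg_of_isUnit hP, neg_mulVec, mulVec_neg]

lemma differentiableAt_det {m : Type*} [Fintype m] [DecidableEq m] {M : ℂ → Matrix m m ℂ} {w : ℂ}
    (h : ∀ i j, DifferentiableAt ℂ (fun z => M z i j) w) :
    DifferentiableAt ℂ (fun z => (M z).det) w := by
  simp only [det_apply]
  refine DifferentiableAt.fun_sum fun σ _ => DifferentiableAt.const_smul ?_ _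
  exact DifferentiableAt.fun_finsetProd fun i _ => h _ _

lemma differentiableAt_inv {m : Type*} [Fintype m] [DecidableEq m] {M : ℂ → Matrix m m ℂ} {w : ℂ}
    (h : ∀ i j, DifferentiableAt ℂ (fun z => M z i j) w) (hw : IsUnit (M w).det) (i j : m) :
    DifferentiableAt ℂ (fun z => (M z)⁻¹ i j) w := by
  simp only [Matrix.inv_def, Ring.inverse_eq_inv', Matrix.smul_apply, smul_eq_mul, adjugate_apply]
  refine ((differentiableAt_det h).inv hw.ne_zero).mul (differentiableAt_det fun a b => ?_)
  by_cases ha : a = j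
  · subst ha; simp
  · simpa [updateRow_ne ha] using h a b

lemma differentiableAt_mul {l m n : Type*} [Fintype m] {M : ℂ → Matrix l m ℂ}
    {N : ℂ → Matrix m n ℂ} {w : ℂ} (hM : ∀ i j, DifferentiableAt ℂ (fun z => M z i j) w)
    (hN : ∀ i j, DifferentiableAt ℂ (fun z => N z i j) w) (i : l) (j : n) :
    DifferentiableAt ℂ (fun z => (M z * N z) i j) w := by
  simp only [Matrix.mul_apply]
  exact DifferentiableAt.fun_sum fun k _ => (hM i k).mul (hN k j)

section

variable {T P : Matrix ι ι ℂ} {E C : ι → ℂ}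

lemma IsSteinData.differentiableAt_resolvent (h : IsSteinData T P E C) {w : ℂ} (hw : ‖w‖ ≤ 1)
    (i j : ι) : DifferentiableAt ℂ (fun z : ℂ => (1 - z • Tᴴ)⁻¹ i j) w := by
  refine differentiableAt_inv (fun a b => ?_) (h.isUnit_disk w hw) i j
  simp only [Matrix.sub_apply, Matrix.smul_apply, smul_eq_mul]
  fun_prop

lemma IsSteinData.differentiableAt_thetaMat (h : IsSteinData T P E C) {w : ℂ} (hw : ‖w‖ ≤ 1)
    (i j : Fin 2) : DifferentiableAt ℂ (fun z => thetaMat T P E C z i j) w := by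
  simp only [thetaMat, Matrix.add_apply, Matrix.smul_apply, smul_eq_mul]
  refine (differentiableAt_const _).add (DifferentiableAt.mul (by fun_prop) ?_)
  refine differentiableAt_mul (N := fun _ => cols E (-C)) (fun a b => ?_)
    (fun a b => differentiableAt_const _) i j
  refine differentiableAt_mul (N := fun _ => (1 - T)⁻¹) (fun a b => ?_)
    (fun a b => differentiableAt_const _) a b
  refine differentiableAt_mul (N := fun _ => P⁻¹) (fun a b => ?_)
    (fun a b => differentiableAt_const _) a b
  exact differentiableAt_mul (M := fun _ => (cols E C)ᴴ) (fun a b => differentiableAt_const _)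
    (h.differentiableAt_resolvent hw) a b

lemma IsSteinData.isUnit_det_one_sub (h : IsSteinData T P E C) : IsUnit (1 - T).det := by
  have h1 := h.isUnit_disk 1 (by simp)
  have h2 : (1 - (1 : ℂ) • Tᴴ) = (1 - T)ᴴ := by
    rw [one_smul, conjTranspose_sub, conjTranspose_one]
  rw [h2, det_conjTranspose] at h1
  simpa using h1

lemma IsSteinData.isUnit_det_one_sub_conjTranspose (h : IsSteinData T P E C) :
    IsUnit (1 - Tᴴ).det := by
  simpa using h.isUnit_disk 1 (by simp)

/-- The identity behind the `J`-unitarity of `Θ` on the circle; here `v = 1 / w` stands for the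
conjugate of `w`. -/
lemma resolvent_identity {R R' : Matrix ι ι ℂ} (hR : R * (1 - T) = 1)
    (hR' : (1 - Tᴴ) * R' = 1) {w v : ℂ} (hwv : w * v = 1) :
    (w - 1) • (R * ((1 - v • T) * P)) + (v - 1) • (P * (1 - w • Tᴴ) * R') +
      ((w - 1) * (v - 1)) • (R * (P - T * P * Tᴴ) * R') = 0 := by
  have key : (w - 1) • ((1 - v • T) * P * (1 - Tᴴ)) + (v - 1) • ((1 - T) * P * (1 - w • Tᴴ)) +
      ((w - 1) * (v - 1)) • (P - T * P * Tᴴ) = 0 := by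
    simp only [Matrix.sub_mul, Matrix.mul_sub, Matrix.one_mul, Matrix.mul_one, Matrix.smul_mul,
      Matrix.mul_smul, smul_sub,
      smul_smul, Matrix.mul_assoc]
    match_scalars
    · linear_combination hwv
    · linear_combination -hwv
    · linear_combination -hwv
    · linear_combination hwv
  calc _ = R * ((w - 1) • ((1 - v • T) * P * (1 - Tᴴ)) + (v - 1) • ((1 - T) * P * (1 - w • Tᴴ)) +
      ((w - 1) * (v - 1)) • (P - T * P * Tᴴ)) * R' := by
        simp only [Matrix.mul_add, Matrix.add_mul, Matrix.mul_smul, Matrix.smul_mul]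
        congr 2
        · congr 1
          simp only [Matrix.mul_assoc, hR', Matrix.mul_one]
        · congr 1
          rw [Matrix.mul_assoc (1 - T), ← Matrix.mul_assoc R, hR, Matrix.one_mul]
    _ = 0 := by rw [key]; simp

/-- `Θ` is `J`-unitary on the unit circle, for `J = diag(1, -1)`. -/
lemma IsSteinData.thetaMat_mul_conjTranspose (h : IsSteinData T P E C) {w : ℂ} (hw : ‖w‖ = 1) :
    thetaMat T P E C w * diagonal ![1, -1] * (thetaMat T P E C w)ᴴ = diagonal ![1, -1] := by
  set J : Matrix (Fin 2) (Fin 2) ℂ := diagonal ![1, -1] with hJ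
  have hJJ : J * J = 1 := by
    rw [hJ, diagonal_mul_diagonal, ← diagonal_one]; congr 1; ext i; fin_cases i <;> simp
  have hJs : Jᴴ = J := by
    rw [hJ, diagonal_conjTranspose]; congr 1; ext i; fin_cases i <;> simp
  set v := star w with hv
  have hwv : w * v = 1 := by
    rw [hv, Complex.star_def, Complex.mul_conj, Complex.normSq_eq_norm_sq, hw]; simp
  set K := cols E C
  set Φ := (1 - w • Tᴴ)⁻¹
  set R := (1 - T)⁻¹
  have hR : R * (1 - T) = 1 := nonsing_inv_mul _ h.isUnit_det_one_sub
  have hR' : (1 - Tᴴ) * Rᴴ = 1 := by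
    have := congrArg conjTranspose hR
    rwa [conjTranspose_mul, conjTranspose_sub, conjTranspose_one] at this
  have hΦ1 : Φ * (1 - w • Tᴴ) = 1 := nonsing_inv_mul _ (h.isUnit_disk w hw.le)
  have hΦ2 : (1 - v • T) * Φᴴ = 1 := by
    have := congrArg conjTranspose hΦ1
    rwa [conjTranspose_mul, conjTranspose_sub, conjTranspose_one, conjTranspose_smul,
      conjTranspose_conjTranspose] at this
  have hP1 : P⁻¹ * P = 1 := nonsing_inv_mul _ h.isUnit_det
  have hP2 : P * P⁻¹ = 1 := mul_nonsing_inv _ h.isUnit_det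
  have hPs : (P⁻¹)ᴴ = P⁻¹ := by rw [conjTranspose_nonsing_inv, h.isHermitian.eq]
  set X := Kᴴ * Φ * P⁻¹ * R * K with hX
  have hXs : Xᴴ = Kᴴ * (Rᴴ * P⁻¹ * Φᴴ) * K := by
    rw [hX]; simp only [conjTranspose_mul, conjTranspose_conjTranspose, hPs, Matrix.mul_assoc]
  have hth : thetaMat T P E C w = 1 + (w - 1) • (X * J) := by
    rw [thetaMat, cols_neg]; simp only [hX, Matrix.mul_assoc]
    rfl
  have hid := resolvent_identity (P := P) hR hR' hwv
  have hst : P - T * P * Tᴴ = K * J * Kᴴ := by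
    rw [h.stein, ← cols_mul_conjTranspose, cols_neg]
  -- each term is sandwiched between `Kᴴ Φ P⁻¹` and its adjoint
  have hX1 : X = Kᴴ * Φ * P⁻¹ * (R * ((1 - v • T) * P)) * (P⁻¹ * Φᴴ * K) := by
    have e : (R * ((1 - v • T) * P)) * (P⁻¹ * Φᴴ * K) = R * K := by
      calc _ = R * ((1 - v • T) * (P * P⁻¹) * Φᴴ) * K := by simp only [Matrix.mul_assoc]
        _ = R * K := by rw [hP2, Matrix.mul_one, hΦ2, Matrix.mul_one]
    rw [Matrix.mul_assoc _ (R * _), e, hX]; simp only [Matrix.mul_assoc]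
  have hX2 : Xᴴ = Kᴴ * Φ * P⁻¹ * (P * (1 - w • Tᴴ) * Rᴴ) * (P⁻¹ * Φᴴ * K) := by
    have e : Kᴴ * Φ * P⁻¹ * (P * (1 - w • Tᴴ) * Rᴴ) = Kᴴ * Rᴴ := by
      calc _ = Kᴴ * (Φ * ((P⁻¹ * P) * (1 - w • Tᴴ))) * Rᴴ := by simp only [Matrix.mul_assoc]
        _ = Kᴴ * Rᴴ := by rw [hP1, Matrix.one_mul, hΦ1, Matrix.mul_one]
    rw [e, hXs]; simp only [Matrix.mul_assoc]
  have hX3 : X * J * Xᴴ = Kᴴ * Φ * P⁻¹ * (R * (P - T * P * Tᴴ) * Rᴴ) * (P⁻¹ * Φᴴ * K) := by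
    rw [hst, hXs, hX]; simp only [Matrix.mul_assoc]
  have hsum : (w - 1) • X + (v - 1) • Xᴴ + ((w - 1) * (v - 1)) • (X * J * Xᴴ) = 0 := by
    have e : ∀ (A : Matrix (Fin 2) ι ℂ) (B : Matrix ι (Fin 2) ℂ) (X₁ X₂ X₃ : Matrix ι ι ℂ)
        (a b c : ℂ), a • (A * X₁ * B) + b • (A * X₂ * B) + c • (A * X₃ * B) =
          A * (a • X₁ + b • X₂ + c • X₃) * B := fun A B X₁ X₂ X₃ a b c => by
      simp only [Matrix.mul_add, Matrix.add_mul, Matrix.mul_smul, Matrix.smul_mul]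
    rw [hX3]
    conv_lhs => lhs; rw [hX2]; lhs; rw [hX1]
    rw [e, hid]; simp
  have hstar : (thetaMat T P E C w)ᴴ = 1 + (v - 1) • (J * Xᴴ) := by
    rw [hth, conjTranspose_add, conjTranspose_one, conjTranspose_smul, conjTranspose_mul, hJs,
      star_sub, star_one]
  rw [hstar, hth]
  calc _ = J + ((w - 1) • (X * (J * J)) + (v - 1) • ((J * J) * Xᴴ) +
      ((w - 1) * (v - 1)) • (X * (J * J) * J * Xᴴ)) := by
        simp only [Matrix.add_mul, Matrix.mul_add, Matrix.one_mul, Matrix.mul_one,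
          Matrix.smul_mul, Matrix.mul_smul, smul_smul,
          Matrix.mul_assoc, smul_add]
        rw [mul_comm (v - 1)]
        abel
    _ = J := by rw [hJJ, Matrix.mul_one, Matrix.one_mul, hsum, add_zero]

lemma IsSteinData.normSq_thetaMat (h : IsSteinData T P E C) {w : ℂ} (hw : ‖w‖ = 1) :
    ‖thetaMat T P E C w 1 1‖ ^ 2 = 1 + ‖thetaMat T P E C w 1 0‖ ^ 2 := by
  have h1 := congrFun (congrFun (h.thetaMat_mul_conjTranspose hw) 1) 1
  rw [Matrix.mul_apply, Fin.sum_univ_two] at h1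
  simp only [mul_diagonal, conjTranspose_apply, diagonal_apply_eq] at h1
  simp only [cons_val_zero, cons_val_one, mul_one, mul_neg, neg_mul, Complex.star_def,
    Complex.mul_conj, Complex.normSq_eq_norm_sq] at h1
  have h2 : ‖thetaMat T P E C w 1 0‖ ^ 2 - ‖thetaMat T P E C w 1 1‖ ^ 2 = -1 := by
    exact_mod_cast (by push_cast at h1 ⊢; linear_combination h1 : (((‖thetaMat T P E C w 1 0‖ ^ 2 -
      ‖thetaMat T P E C w 1 1‖ ^ 2 : ℝ)) : ℂ) = ((-1 : ℝ) : ℂ))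
  linarith

/-- The determinant of `Θ`. -/
lemma IsSteinData.det_thetaMat (h : IsSteinData T P E C) {w : ℂ} (hw : ‖w‖ ≤ 1) :
    (1 - T).det * ((thetaMat T P E C w).det * (1 - w • Tᴴ).det) =
      (w • (1 : Matrix ι ι ℂ) - T).det * (1 - Tᴴ).det := by
  have hΦ : (1 - w • Tᴴ) * (1 - w • Tᴴ)⁻¹ = 1 := mul_nonsing_inv _ (h.isUnit_disk w hw)
  have hP2 : P * P⁻¹ = 1 := mul_nonsing_inv _ h.isUnit_det
  have hR : (1 - T) * (1 - T)⁻¹ = 1 := mul_nonsing_inv _ h.isUnit_det_one_sub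
  have h1 : (thetaMat T P E C w).det = (1 + (w - 1) • ((1 - w • Tᴴ)⁻¹ * (P⁻¹ * ((1 - T)⁻¹ *
      (P - T * P * Tᴴ))))).det := by
    rw [h.stein, ← cols_mul_conjTranspose, thetaMat, Matrix.mul_assoc, Matrix.mul_assoc,
      Matrix.mul_assoc,
      ← Matrix.mul_smul, det_one_add_mul_comm, Matrix.smul_mul]
    simp only [Matrix.mul_assoc]
  have h2 : (1 - T) * P * ((1 - w • Tᴴ) * (1 + (w - 1) • ((1 - w • Tᴴ)⁻¹ * (P⁻¹ * ((1 - T)⁻¹ *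
      (P - T * P * Tᴴ)))))) = (w • (1 : Matrix ι ι ℂ) - T) * P * (1 - Tᴴ) := by
    rw [Matrix.mul_add, Matrix.mul_one, Matrix.mul_smul, ← Matrix.mul_assoc (1 - w • Tᴴ), hΦ,
      Matrix.one_mul, Matrix.mul_add,
      Matrix.mul_smul, Matrix.mul_assoc (1 - T) P (P⁻¹ * _), ← Matrix.mul_assoc P, hP2,
        Matrix.one_mul, ← Matrix.mul_assoc, hR,
      Matrix.one_mul]
    simp only [Matrix.sub_mul, Matrix.mul_sub, Matrix.one_mul, Matrix.mul_one, Matrix.smul_mul,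
      Matrix.mul_smul, Matrix.mul_assoc]
    module
  have h3 := congrArg det h2
  simp only [det_mul, ← h1] at h3
  have hne := h.isUnit_det.ne_zero
  apply mul_right_cancel₀ hne
  linear_combination h3

/-- The interpolation property: `[E -C] Θ(w)` is divisible by `w - T` from the left, with a
quotient that is holomorphic in the disk. -/
lemma IsSteinData.cols_mul_thetaMat (h : IsSteinData T P E C) {w : ℂ} (hw : ‖w‖ ≤ 1) :
    cols E (-C) * thetaMat T P E C w = (w • (1 : Matrix ι ι ℂ) - T) *
      ((1 - T)⁻¹ * cols E (-C) + (w - 1) • (P * Tᴴ * (1 - w • Tᴴ)⁻¹ *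
        (P⁻¹ * (1 - T)⁻¹ * cols E (-C)))) := by
  set Φ := (1 - w • Tᴴ)⁻¹
  set L := cols E (-C)
  set R := (1 - T)⁻¹
  have hΦ1 : (1 - w • Tᴴ) * Φ = 1 := mul_nonsing_inv _ (h.isUnit_disk w hw)
  have hP2 : P * P⁻¹ = 1 := mul_nonsing_inv _ h.isUnit_det
  have hR : (1 - T) * R = 1 := mul_nonsing_inv _ h.isUnit_det_one_sub
  have h1 : P - T * P * Tᴴ = (w • (1 : Matrix ι ι ℂ) - T) * (P * Tᴴ) + P * (1 - w • Tᴴ) := by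
    simp only [Matrix.sub_mul, Matrix.mul_sub, Matrix.one_mul, Matrix.mul_one, Matrix.smul_mul,
      Matrix.mul_smul, Matrix.mul_assoc]
    abel
  have h2 : L * thetaMat T P E C w = L + (w - 1) • ((P - T * P * Tᴴ) * (Φ * (P⁻¹ * (R * L)))) := by
    rw [h.stein, ← cols_mul_conjTranspose, thetaMat, Matrix.mul_add, Matrix.mul_one,
      Matrix.mul_smul]
    simp only [Matrix.mul_assoc]
    rfl
  have h3 : P * (1 - w • Tᴴ) * (Φ * (P⁻¹ * (R * L))) = R * L := by
    calc _ = P * ((1 - w • Tᴴ) * Φ) * P⁻¹ * (R * L) := by simp only [Matrix.mul_assoc]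
      _ = R * L := by rw [hΦ1, Matrix.mul_one, hP2, Matrix.one_mul]
  have h4 : (w • (1 : Matrix ι ι ℂ) - T) * (R * L) = L + (w - 1) • (R * L) := by
    have e : w • (1 : Matrix ι ι ℂ) - T = (1 - T) + (w - 1) • 1 := by module
    rw [e, Matrix.add_mul, ← Matrix.mul_assoc, hR, Matrix.one_mul, Matrix.smul_mul, Matrix.one_mul]
  rw [h2, h1, Matrix.add_mul, h3, Matrix.mul_add, h4, Matrix.mul_smul, smul_add]
  simp only [Matrix.mul_assoc]
  abel

/-- The matrix whose eigenvalues are the Cayley transforms of the zeros of `Θ₂₂`. -/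
noncomputable def lyapMat (T P : Matrix ι ι ℂ) (C : ι → ℂ) : Matrix ι ι ℂ :=
  (1 + Tᴴ + (2 : ℂ) • (P⁻¹ * (1 - T)⁻¹ * vecMulVec C (star C))) * (1 - Tᴴ)⁻¹

lemma IsSteinData.thetaMat_one_one_mul (h : IsSteinData T P E C) {w : ℂ} (hw : ‖w‖ ≤ 1) :
    (2 : ℂ) ^ Fintype.card ι * (thetaMat T P E C w 1 1 * (1 - w • Tᴴ).det) =
      ((1 - w) • lyapMat T P C + (1 + w) • (1 : Matrix ι ι ℂ)).det * (1 - Tᴴ).det := by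
  have hΦ : (1 - w • Tᴴ) * (1 - w • Tᴴ)⁻¹ = 1 := mul_nonsing_inv _ (h.isUnit_disk w hw)
  have hS : (1 - Tᴴ)⁻¹ * (1 - Tᴴ) = 1 := nonsing_inv_mul _ h.isUnit_det_one_sub_conjTranspose
  have h1 : thetaMat T P E C w 1 1 = (1 + (1 - w) • ((1 - w • Tᴴ)⁻¹ * (P⁻¹ * (1 - T)⁻¹ *
      vecMulVec C (star C)))).det := by
    have e : (1 - w) • ((1 - w • Tᴴ)⁻¹ * (P⁻¹ * (1 - T)⁻¹ * vecMulVec C (star C))) =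
        replicateCol Unit (((1 - w) • ((1 - w • Tᴴ)⁻¹ * P⁻¹ * (1 - T)⁻¹)) *ᵥ C) *
          replicateRow Unit (star C) := by
      rw [← vecMulVec_eq Unit, ← mul_vecMulVec, Matrix.smul_mul]
      simp only [Matrix.mul_assoc]
    rw [e, det_one_add_replicateCol_mul_replicateRow, thetaMat_apply, smul_mulVec, dotProduct_smul]
    simp [mulVec_neg]
    ring
  rw [h1, ← mul_comm (det (1 - w • Tᴴ)), ← det_mul, ← det_smul, ← det_mul]
  congr 1
  rw [Matrix.mul_add, Matrix.mul_one, Matrix.mul_smul, ← Matrix.mul_assoc, hΦ, Matrix.one_mul,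
    Matrix.add_mul, Matrix.smul_mul, lyapMat,
    Matrix.mul_assoc _ _ (1 - Tᴴ), hS, Matrix.mul_one, Matrix.smul_mul, Matrix.one_mul]
  module

/-- The Lyapunov equation of `lyapMat`, with a positive semidefinite right-hand side. -/
lemma IsSteinData.posSemidef_lyap (h : IsSteinData T P E C) :
    (P * lyapMat T P C + (lyapMat T P C)ᴴ * P).PosSemidef := by
  set G := vecMulVec C (star C) with hG
  set R := (1 - T)⁻¹ with hRdef
  have hGs : Gᴴ = G := by rw [hG, conjTranspose_vecMulVec, star_star]
  have hR : R * (1 - T) = 1 := nonsing_inv_mul _ h.isUnit_det_one_sub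
  have hRs : (1 - Tᴴ)⁻¹ = Rᴴ := by
    rw [hRdef, conjTranspose_nonsing_inv, conjTranspose_sub, conjTranspose_one]
  have hR3 : (1 - Tᴴ) * Rᴴ = 1 := by
    rw [← hRs]; exact mul_nonsing_inv _ h.isUnit_det_one_sub_conjTranspose
  have hP2 : P * P⁻¹ = 1 := mul_nonsing_inv _ h.isUnit_det
  have h1 : P * lyapMat T P C = R * ((1 - T) * P * (1 + Tᴴ) + (2 : ℂ) • G) * Rᴴ := by
    rw [lyapMat, hRs, ← Matrix.mul_assoc, Matrix.mul_add P, Matrix.mul_smul, Matrix.mul_add R,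
      ← Matrix.mul_assoc P (P⁻¹ * _),
      ← Matrix.mul_assoc P, hP2, Matrix.one_mul, ← Matrix.mul_assoc R, ← Matrix.mul_assoc R, hR,
        Matrix.one_mul, Matrix.mul_smul]
  have h2 : (lyapMat T P C)ᴴ * P = R * ((1 + T) * P * (1 - Tᴴ) + (2 : ℂ) • G) * Rᴴ := by
    have e := congrArg conjTranspose h1
    rw [conjTranspose_mul, h.isHermitian.eq] at e
    rw [e]
    simp only [conjTranspose_mul, conjTranspose_add, conjTranspose_sub, conjTranspose_smul, hGs,
      conjTranspose_one, conjTranspose_conjTranspose, h.isHermitian.eq]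
    simp [Matrix.mul_assoc]
  have h3 : P * lyapMat T P C + (lyapMat T P C)ᴴ * P =
      R * ((2 : ℂ) • (vecMulVec E (star E) + vecMulVec C (star C))) * Rᴴ := by
    rw [h1, h2, ← Matrix.add_mul, ← Matrix.mul_add]
    congr 2
    have e : (1 - T) * P * (1 + Tᴴ) + (1 + T) * P * (1 - Tᴴ) = (2 : ℂ) • (P - T * P * Tᴴ) := by
      simp only [Matrix.sub_mul, Matrix.mul_sub, Matrix.add_mul, Matrix.mul_add, Matrix.one_mul,
        Matrix.mul_one, Matrix.mul_assoc]
      module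
    rw [h.stein] at e
    calc _ = ((1 - T) * P * (1 + Tᴴ) + (1 + T) * P * (1 - Tᴴ)) + (4 : ℂ) • G := by module
      _ = _ := by rw [e]; module
  rw [h3]
  exact (((posSemidef_vecMulVec_self_star E).add (posSemidef_vecMulVec_self_star C)).smul
    (by norm_num)).mul_mul_conjTranspose_same R

/-- Homogeneous form of the factorization of the characteristic polynomial. -/
lemma det_smul_add_smul (Z : Matrix ι ι ℂ) {a : ℂ} (ha : a ≠ 0) (b : ℂ) :
    (a • Z + b • (1 : Matrix ι ι ℂ)).det = (Z.charpoly.roots.map fun μ => a * μ + b).prod := by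
  have h1 : a • Z + b • (1 : Matrix ι ι ℂ) = (-a) • (scalar ι (-b / a) - Z) := by
    rw [scalar_apply, ← smul_one_eq_diagonal, smul_sub, smul_smul]
    rw [show -a * (-b / a) = b by field_simp]
    module
  have hs := IsAlgClosed.splits Z.charpoly
  have hcard : Multiset.card Z.charpoly.roots = Fintype.card ι := by
    rw [← Matrix.charpoly_natDegree_eq_dim Z]
    exact Polynomial.splits_iff_card_roots.1 hs
  rw [h1, det_smul, ← eval_charpoly, ← hcard, hs.eval_eq_prod_roots_of_monic
    Z.charpoly_monic, ← Multiset.prod_replicate, ← Multiset.map_const', ← Multiset.prod_map_mul]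
  congr 1
  refine Multiset.map_congr rfl fun μ _ => ?_
  field_simp
  ring

end

end

/-! ### Counting the zeros of `Θ₂₁ S + Θ₂₂ B` -/

section

variable {ι : Type*} [Fintype ι] [DecidableEq ι] {T P : Matrix ι ι ℂ} {E C : ι → ℂ}

/-- The Cayley transform `ζ ↦ (ζ + 1) / (ζ - 1)` maps the left half-plane into the disk. -/
lemma norm_cayley_lt_one {ζ : ℂ} (h : ζ.re < 0) : ‖(ζ + 1) / (ζ - 1)‖ < 1 := by
  have hne : ζ - 1 ≠ 0 := fun h0 => by
    rw [sub_eq_zero.1 h0] at h; norm_num at h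
  rw [norm_div, div_lt_one (norm_pos_iff.2 hne), ← sq_lt_sq₀ (norm_nonneg _) (norm_nonneg _),
    Complex.sq_norm, Complex.sq_norm, Complex.normSq_apply, Complex.normSq_apply]
  simp only [Complex.add_re, Complex.sub_re, Complex.add_im, Complex.sub_im, Complex.one_re,
    Complex.one_im]
  nlinarith

/-- The factor of an eigenvalue in the closed right half-plane has no zero in the disk. For `ζ = 1`
it is the constant `2`. -/
lemma cayley_factor_ne_zero {ζ w : ℂ} (h : 0 ≤ ζ.re) (hw : ‖w‖ < 1) :
    (1 - w) * ζ + (1 + w) ≠ 0 := by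
  intro h0
  have h1 : w * (ζ - 1) = ζ + 1 := by linear_combination -h0
  have h2 : ‖w‖ * ‖ζ - 1‖ = ‖ζ + 1‖ := by rw [← norm_mul, h1]
  have h3 : ‖ζ - 1‖ ≤ ‖ζ + 1‖ := by
    rw [← sq_le_sq₀ (norm_nonneg _) (norm_nonneg _),
      Complex.sq_norm, Complex.sq_norm, Complex.normSq_apply, Complex.normSq_apply]
    simp only [Complex.add_re, Complex.sub_re, Complex.add_im, Complex.sub_im, Complex.one_re,
      Complex.one_im]
    nlinarith
  have h4 : ζ - 1 = 0 := by
    by_contra hne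
    have := norm_pos_iff.2 hne
    nlinarith
  rw [h4, mul_zero] at h1
  have h5 : ζ = 1 := sub_eq_zero.1 h4
  rw [h5] at h1
  norm_num at h1

lemma IsSteinData.re_ne_zero (h : IsSteinData T P E C) :
    ∀ ζ ∈ (lyapMat T P C).charpoly.roots, ζ.re ≠ 0 := by
  intro ζ hζ hre
  have hne : ζ - 1 ≠ 0 := fun h0 => by
    rw [sub_eq_zero.1 h0] at hre; norm_num at hre
  set w := (ζ + 1) / (ζ - 1) with hw
  have hwn : ‖w‖ = 1 := by
    rw [hw, norm_div, div_eq_one_iff_eq (norm_ne_zero_iff.2 hne), ← sq_eq_sq₀ (norm_nonneg _)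
      (norm_nonneg _), Complex.sq_norm, Complex.sq_norm, Complex.normSq_apply,
      Complex.normSq_apply]
    simp only [Complex.add_re, Complex.sub_re, Complex.add_im, Complex.sub_im, Complex.one_re,
      Complex.one_im, hre]
    ring
  have h1w : 1 - w ≠ 0 := by
    have : 1 - w = -2 / (ζ - 1) := by rw [hw]; field_simp; ring
    rw [this]
    exact div_ne_zero (by norm_num) hne
  have h1 := h.thetaMat_one_one_mul hwn.le
  rw [det_smul_add_smul _ h1w, Multiset.prod_eq_zero, zero_mul] at h1
  · have h2 : thetaMat T P E C w 1 1 = 0 := by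
      simpa [(h.isUnit_disk w hwn.le).ne_zero] using h1
    have h3 := h.normSq_thetaMat hwn
    rw [h2] at h3
    have h4 := sq_nonneg ‖thetaMat T P E C w 1 0‖
    rw [norm_zero] at h3
    linarith
  · exact Multiset.mem_map.2 ⟨ζ, hζ, by rw [hw]; field_simp; ring⟩

lemma IsSteinData.countP_lyapMat (h : IsSteinData T P E C) :
    Multiset.card ((lyapMat T P C).charpoly.roots.filter fun ζ => ζ.re < 0) = sqNeg P := by
  classical
  rw [← countP_eq_sqNeg h.isHermitian ((isUnit_iff_isUnit_det _).2 h.isUnit_det) h.posSemidef_lyap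
    h.re_ne_zero, Multiset.countP_eq_card_filter]

/-- `Θ₂₂` has `sqNeg P` zeros in the disk, recorded in a factorization. -/
lemma IsSteinData.exists_thetaMat_factor (h : IsSteinData T P E C) :
    ∃ (s : Multiset ℂ) (g : ℂ → ℂ), s.card = sqNeg P ∧ (∀ a ∈ s, a ∈ ball (0 : ℂ) 1) ∧
      DifferentiableOn ℂ g (ball 0 1) ∧ (∀ w ∈ ball (0 : ℂ) 1, g w ≠ 0) ∧
      ∀ w ∈ ball (0 : ℂ) 1, thetaMat T P E C w 1 1 = (s.map fun a => w - a).prod * g w := by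
  classical
  set r := (lyapMat T P C).charpoly.roots with hr
  set rn := r.filter fun ζ => ζ.re < 0 with hrn
  set rp := r.filter fun ζ => ¬ ζ.re < 0 with hrp
  have hD : ∀ w ∈ ball (0 : ℂ) 1, (1 - w • Tᴴ).det ≠ 0 := fun w hw =>
    (h.isUnit_disk w (by simpa using (mem_ball_zero_iff.1 hw).le)).ne_zero
  refine ⟨rn.map fun ζ => (ζ + 1) / (ζ - 1), fun w => (rn.map fun ζ => 1 - ζ).prod *
    (rp.map fun ζ => (1 - w) * ζ + (1 + w)).prod * (1 - Tᴴ).det /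
      (2 ^ Fintype.card ι * (1 - w • Tᴴ).det), ?_, ?_, ?_, ?_, ?_⟩
  · rw [Multiset.card_map, ← h.countP_lyapMat]
  · intro a ha
    obtain ⟨ζ, hζ, rfl⟩ := Multiset.mem_map.1 ha
    exact mem_ball_zero_iff.2 (norm_cayley_lt_one (Multiset.mem_filter.1 hζ).2)
  · intro w hw
    refine DifferentiableAt.differentiableWithinAt (DifferentiableAt.div ?_ ?_ ?_)
    · refine ((differentiableAt_const _).mul ?_).mul_const _
      clear hrp
      induction rp using Multiset.induction_on with
      | empty => simp
      | cons a s ih =>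
        simp only [Multiset.map_cons, Multiset.prod_cons]
        fun_prop
    · refine (differentiableAt_const _).mul (differentiableAt_det fun a b => ?_)
      simp only [Matrix.sub_apply, Matrix.smul_apply, smul_eq_mul]
      fun_prop
    · exact mul_ne_zero (by positivity) (hD w hw)
  · intro w hw
    refine div_ne_zero (mul_ne_zero (mul_ne_zero ?_ ?_)
      h.isUnit_det_one_sub_conjTranspose.ne_zero) (mul_ne_zero (by positivity) (hD w hw))
    · intro h0
      obtain ⟨ζ, hζ, h1⟩ := Multiset.mem_map.1 (Multiset.prod_eq_zero_iff.1 h0)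
      have h2 := (Multiset.mem_filter.1 hζ).2
      rw [← sub_eq_zero.1 h1] at h2
      norm_num at h2
    · intro h0
      obtain ⟨ζ, hζ, h1⟩ := Multiset.mem_map.1 (Multiset.prod_eq_zero_iff.1 h0)
      exact cayley_factor_ne_zero (not_lt.1 (Multiset.mem_filter.1 hζ).2)
        (mem_ball_zero_iff.1 hw) h1
  · intro w hw
    have hw1 := mem_ball_zero_iff.1 hw
    have h1w : 1 - w ≠ 0 := fun h0 => by
      rw [← sub_eq_zero.1 h0] at hw1; norm_num at hw1
    have h1 := h.thetaMat_one_one_mul hw1.le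
    rw [det_smul_add_smul _ h1w, ← hr, ← Multiset.filter_add_not (fun ζ : ℂ => ζ.re < 0) r,
      ← hrn, ← hrp, Multiset.map_add, Multiset.prod_add] at h1
    have h2 : (rn.map fun ζ => (1 - w) * ζ + (1 + w)).prod =
        ((rn.map fun ζ => (ζ + 1) / (ζ - 1)).map fun a => w - a).prod *
          (rn.map fun ζ => 1 - ζ).prod := by
      rw [Multiset.map_map, ← Multiset.prod_map_mul]
      congr 1
      refine Multiset.map_congr rfl fun ζ hζ => ?_
      have hne : ζ - 1 ≠ 0 := fun h0 => by
        have h2 := (Multiset.mem_filter.1 hζ).2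
        rw [sub_eq_zero.1 h0] at h2
        norm_num at h2
      simp only [Function.comp]
      field_simp
      ring
    rw [h2] at h1
    have h3 := hD w hw
    have h4 : (2 : ℂ) ^ Fintype.card ι ≠ 0 := by positivity
    field_simp
    linear_combination h1

/-- The rational expression of a finite Blaschke product. -/
noncomputable def blaschkeProd {m : ℕ} (c : ℂ) (a : Fin m → ℂ) (z : ℂ) : ℂ :=
  c * ∏ i, (z - a i) / (1 - star (a i) * z)

lemma one_sub_star_mul_ne_zero {a z : ℂ} (ha : a ∈ ball (0 : ℂ) 1) (hz : ‖z‖ ≤ 1) :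
    1 - star a * z ≠ 0 := by
  intro h0
  have h1 : ‖star a * z‖ = 1 := by rw [← sub_eq_zero.1 h0, norm_one]
  have h2 := mem_ball_zero_iff.1 ha
  rw [norm_mul, norm_star] at h1
  nlinarith [norm_nonneg a, norm_nonneg z]

lemma differentiableAt_blaschkeProd {m : ℕ} {c : ℂ} {a : Fin m → ℂ}
    (ha : ∀ i, a i ∈ ball (0 : ℂ) 1) {z : ℂ} (hz : ‖z‖ ≤ 1) :
    DifferentiableAt ℂ (blaschkeProd c a) z := by
  refine DifferentiableAt.const_mul (DifferentiableAt.fun_finsetProd fun i _ => ?_) _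
  exact DifferentiableAt.div (by fun_prop) (by fun_prop) (one_sub_star_mul_ne_zero (ha i) hz)

lemma normSq_one_sub_star_mul (a z : ℂ) :
    ‖1 - star a * z‖ ^ 2 - ‖z - a‖ ^ 2 = (1 - ‖a‖ ^ 2) * (1 - ‖z‖ ^ 2) := by
  simp only [Complex.sq_norm, Complex.normSq_apply, Complex.sub_re, Complex.sub_im, Complex.mul_re,
    Complex.mul_im, Complex.star_def, Complex.conj_re, Complex.conj_im, Complex.one_re,
    Complex.one_im]
  ring

lemma norm_blaschkeProd_of_norm_eq_one {m : ℕ} {c : ℂ} {a : Fin m → ℂ} (hc : ‖c‖ = 1)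
    (ha : ∀ i, a i ∈ ball (0 : ℂ) 1) {z : ℂ} (hz : ‖z‖ = 1) : ‖blaschkeProd c a z‖ = 1 := by
  rw [blaschkeProd, norm_mul, hc, one_mul, norm_prod]
  refine Finset.prod_eq_one fun i _ => ?_
  rw [norm_div, div_eq_one_iff_eq (norm_ne_zero_iff.2 (one_sub_star_mul_ne_zero (ha i) hz.le)),
    ← sq_eq_sq₀ (norm_nonneg _) (norm_nonneg _)]
  have := normSq_one_sub_star_mul (a i) z
  rw [hz] at this
  linarith

lemma norm_blaschkeProd_le_one {m : ℕ} {c : ℂ} {a : Fin m → ℂ} (hc : ‖c‖ = 1)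
    (ha : ∀ i, a i ∈ ball (0 : ℂ) 1) {z : ℂ} (hz : ‖z‖ ≤ 1) : ‖blaschkeProd c a z‖ ≤ 1 := by
  rw [blaschkeProd, norm_mul, hc, one_mul, norm_prod]
  refine Finset.prod_le_one (fun i _ => norm_nonneg _) fun i _ => ?_
  rw [norm_div, div_le_one (norm_pos_iff.2 (one_sub_star_mul_ne_zero (ha i) hz)),
    ← sq_le_sq₀ (norm_nonneg _) (norm_nonneg _)]
  have h1 := normSq_one_sub_star_mul (a i) z
  have h2 := mem_ball_zero_iff.1 (ha i)
  have h3 : 0 ≤ (1 - ‖a i‖ ^ 2) * (1 - ‖z‖ ^ 2) := by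
    apply mul_nonneg <;> nlinarith [norm_nonneg (a i), norm_nonneg z]
  linarith

lemma IsBlaschke.isSchur {m : ℕ} {B : ℂ → ℂ} (hB : IsBlaschke m B) : IsSchur B := by
  obtain ⟨c, a, hc, ha, hBz⟩ := hB
  have hd : DifferentiableOn ℂ B (ball 0 1) := DifferentiableOn.congr (f := blaschkeProd c a)
    (fun z hz => (differentiableAt_blaschkeProd ha
      (mem_ball_zero_iff.1 hz).le).differentiableWithinAt) hBz
  refine ⟨hd.analyticOnNhd isOpen_ball, fun z hz => mem_closedBall_zero_iff.2 ?_⟩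
  rw [hBz z hz]
  exact norm_blaschkeProd_le_one hc ha (mem_ball_zero_iff.1 hz).le

/-- A function continuous on the closed disk and positive on the circle is positive on an
annulus. -/
lemma exists_pos_near_circle {F : ℂ → ℝ} (hF : ContinuousOn F (closedBall 0 1))
    (hpos : ∀ z : ℂ, ‖z‖ = 1 → 0 < F z) :
    ∃ r₀ < (1 : ℝ), ∀ z : ℂ, r₀ < ‖z‖ → ‖z‖ < 1 → 0 < F z := by
  set K : Set ℂ := closedBall 0 1 ∩ F ⁻¹' Set.Iic 0
  have hKc : IsCompact K := (isCompact_closedBall (0 : ℂ) 1).of_isClosed_subset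
    (hF.preimage_isClosed_of_isClosed isClosed_closedBall isClosed_Iic) Set.inter_subset_left
  rcases K.eq_empty_or_nonempty with hemp | hne
  · refine ⟨0, one_pos, fun z _ hz => ?_⟩
    by_contra hcon
    have : z ∈ K := ⟨mem_closedBall_zero_iff.2 hz.le, not_lt.1 hcon⟩
    rw [hemp] at this
    exact this
  · obtain ⟨x, hx, hmax⟩ := hKc.exists_isMaxOn hne continuous_norm.continuousOn
    refine ⟨‖x‖, lt_of_le_of_ne (mem_closedBall_zero_iff.1 hx.1)
      fun h1 => absurd (hpos x h1) (not_lt.2 hx.2), fun z hz1 hz => ?_⟩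
    by_contra hcon
    exact absurd (hmax (show z ∈ K from ⟨mem_closedBall_zero_iff.2 hz.le, not_lt.1 hcon⟩))
      (not_le.2 hz1)

/-- The number of zeros of the denominator: on the circle `Θ₂₂ B` dominates `Θ₂₁ S`. -/
theorem IsSteinData.numZeros_denominator (h : IsSteinData T P E C) {κ : ℕ} {S B : ℂ → ℂ}
    (hS : IsSchur S) (hB : IsBlaschke κ B) :
    numZeros (fun w => thetaMat T P E C w 1 0 * S w + thetaMat T P E C w 1 1 * B w) =
      ((sqNeg P + κ : ℕ) : ℕ∞) := by
  obtain ⟨s, g, hcard, hs, hg, hg0, hfac⟩ := h.exists_thetaMat_factor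
  obtain ⟨c, a, hc, ha, hBz⟩ := hB
  have hth : ∀ i j, ∀ w : ℂ, ‖w‖ ≤ 1 → DifferentiableAt ℂ (fun z => thetaMat T P E C z i j) w :=
    fun i j w hw => h.differentiableAt_thetaMat hw i j
  have hden : ∀ w ∈ ball (0 : ℂ) 1, ∏ i, (1 - star (a i) * w) ≠ 0 := fun w hw =>
    Finset.prod_ne_zero_iff.2 fun i _ =>
      one_sub_star_mul_ne_zero (ha i) (mem_ball_zero_iff.1 hw).le
  have hprod : ∀ w ∈ ball (0 : ℂ) 1, ((s + Finset.univ.val.map a).map fun b => w - b).prod *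
      (g w * (c / ∏ i, (1 - star (a i) * w))) = thetaMat T P E C w 1 1 * B w := by
    intro w hw
    rw [hfac w hw, hBz w hw, Multiset.map_add, Multiset.prod_add, Multiset.map_map,
      Finset.prod_div_distrib]
    change _ * (∏ i, (w - a i)) * _ = _
    field_simp
  have hmain := numZeros_eq_card (s := s + Finset.univ.val.map a)
    (h := fun w => g w * (c / ∏ i, (1 - star (a i) * w)))
    (g := fun w => thetaMat T P E C w 1 0 * S w)
    (V := fun w => thetaMat T P E C w 1 0 * S w + thetaMat T P E C w 1 1 * B w) ?_ ?_ ?_ ?_ ?_ ?_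
  · rw [hmain]
    simp [hcard]
  · intro b hb
    rcases Multiset.mem_add.1 hb with hb | hb
    · exact hs b hb
    · obtain ⟨i, -, rfl⟩ := Multiset.mem_map.1 hb
      exact ha i
  · intro w hw
    refine (hg w hw).mul (DifferentiableAt.differentiableWithinAt
      (DifferentiableAt.div (by fun_prop) ?_ (hden w hw)))
    exact DifferentiableAt.fun_finsetProd fun i _ => by fun_prop
  · intro w hw
    exact mul_ne_zero (hg0 w hw)
      (div_ne_zero (norm_ne_zero_iff.1 (by rw [hc]; norm_num)) (hden w hw))
  · intro w hw
    exact ((hth 1 0 w (mem_ball_zero_iff.1 hw).le).differentiableWithinAt).mul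
      (hS.1.differentiableOn w hw)
  · intro w hw
    rw [hprod w hw]
    ring
  · obtain ⟨r₀, hr₀, hpos⟩ := exists_pos_near_circle
      (F := fun w => ‖thetaMat T P E C w 1 1 * blaschkeProd c a w‖ - ‖thetaMat T P E C w 1 0‖) (by
        intro w hw
        have hw' := mem_closedBall_zero_iff.1 hw
        exact ((((hth 1 1 w hw').continuousAt.mul
          (differentiableAt_blaschkeProd ha hw').continuousAt).norm).sub
            (hth 1 0 w hw').continuousAt.norm).continuousWithinAt) (by
        intro w hw
        have h1 := h.normSq_thetaMat hw
        rw [norm_mul, norm_blaschkeProd_of_norm_eq_one hc ha hw, mul_one, sub_pos,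
          ← sq_lt_sq₀ (norm_nonneg _) (norm_nonneg _)]
        linarith)
    refine ⟨r₀, hr₀, fun w hw1 hw2 => ?_⟩
    have hw : w ∈ ball (0 : ℂ) 1 := mem_ball_zero_iff.2 hw2
    have h1 := hpos w hw1 hw2
    rw [hprod w hw, norm_mul (thetaMat T P E C w 1 0)]
    have h2 : ‖S w‖ ≤ 1 := mem_closedBall_zero_iff.1 (hS.2 hw)
    have h3 : B w = blaschkeProd c a w := hBz w hw
    rw [h3]
    nlinarith [norm_nonneg (thetaMat T P E C w 1 0)]

/-- The number of zeros of the numerator, by exchanging the roles of `E` and `C`. -/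
theorem IsSteinData.numZeros_numerator (h : IsSteinData T P E C) {m : ℕ} {S B : ℂ → ℂ}
    (hS : IsBlaschke m S) (hB : IsSchur B) :
    numZeros (fun w => thetaMat T P E C w 0 0 * S w + thetaMat T P E C w 0 1 * B w) =
      ((sqPos P + m : ℕ) : ℕ∞) := by
  rw [← sqNeg_neg h.isHermitian, ← h.swap.numZeros_denominator hB hS]
  refine congrArg numZeros (funext fun w => ?_)
  rw [thetaMat_swap_one_one h.isUnit_det, thetaMat_swap_one_zero h.isUnit_det, add_comm]

end

/-! ### The Pick matrix solves the Stein equation -/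

section

variable {k : ℕ}

lemma det_smul_one_sub_jordanBlock (n : ℕ) (z a v : ℂ) :
    (a • (1 : Matrix (Fin n) (Fin n) ℂ) - v • jordanBlock n z).det = (a - v * z) ^ n := by
  rw [det_of_isLowerTriangular]
  · simp [jordanBlock]
  · intro i j hij
    have hij' : i < j := hij
    have h1 : i ≠ j := hij'.ne
    have h2 : ¬ (i : ℕ) = (j : ℕ) + 1 := by omega
    simp [jordanBlock, h1, h2, Matrix.one_apply_ne]

lemma det_blockDiagonal'_eq_prod {n : Fin k → ℕ} (M : ∀ i, Matrix (Fin (n i)) (Fin (n i)) ℂ) :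
    (blockDiagonal' M).det = ∏ i, (M i).det := by
  have h : (blockDiagonal' M).BlockTriangular Sigma.fst := fun p q hpq =>
    blockDiagonal'_apply_ne M p.2 q.2 hpq.ne'
  rw [h.det_fintype]
  refine Finset.prod_congr rfl fun i _ => ?_
  rw [← det_submatrix_equiv_self (Equiv.sigmaSubtype i).symm]
  congr 1
  ext a b
  exact blockDiagonal'_apply_eq M i a b

lemma det_smul_one_sub_matT (n : Fin k → ℕ) (z : Fin k → ℂ) (a v : ℂ) :
    (a • (1 : Matrix (Σ i, Fin (n i)) (Σ i, Fin (n i)) ℂ) - v • matT n z).det =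
      ∏ i, (a - v * z i) ^ n i := by
  rw [matT, ← blockDiagonal'_one, ← blockDiagonal'_smul, ← blockDiagonal'_smul,
    ← blockDiagonal'_sub, det_blockDiagonal'_eq_prod]
  exact Finset.prod_congr rfl fun i _ => det_smul_one_sub_jordanBlock (n i) (z i) a v

lemma isUnit_det_one_sub_smul_matT {n : Fin k → ℕ} {z : Fin k → ℂ}
    (hz : ∀ i, z i ∈ ball (0 : ℂ) 1) {w : ℂ} (hw : ‖w‖ ≤ 1) :
    IsUnit (1 - w • (matT n z)ᴴ).det := by
  have h1 : 1 - w • (matT n z)ᴴ = ((1 : ℂ) • (1 : Matrix _ _ ℂ) - star w • matT n z)ᴴ := by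
    simp
  rw [h1, det_conjTranspose, det_smul_one_sub_matT, isUnit_star, isUnit_iff_ne_zero]
  refine Finset.prod_ne_zero_iff.2 fun i _ => pow_ne_zero _ ?_
  have h2 := one_sub_star_mul_ne_zero (hz i) hw
  intro h3
  apply h2
  have := congrArg star h3
  simp only [star_sub, star_one, star_mul', star_star, star_zero] at this
  rw [← this]; ring

section

open scoped Matrix.Norms.L2Operator

/-- A matrix whose spectrum lies in the open unit disk has a geometrically decaying sequence of
powers, by Gelfand's formula. -/
lemma summable_pow_mul_mul_conjTranspose_pow {ι : Type*} [Fintype ι] [DecidableEq ι]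
    {T : Matrix ι ι ℂ} (hT : ∀ μ ∈ spectrum ℂ T, ‖μ‖ < 1) (M : Matrix ι ι ℂ) :
    Summable fun j : ℕ => T ^ j * M * Tᴴ ^ j := by
  rcases isEmpty_or_nonempty ι with hι | hι
  · exact summable_zero.congr fun j => Subsingleton.elim _ _
  have : CompleteSpace (Matrix ι ι ℂ) := FiniteDimensional.complete ℂ _
  have hr : spectralRadius ℂ T < (1 : NNReal) :=
    spectrum.spectralRadius_lt_of_forall_lt T fun μ hμ => hT μ hμ
  obtain ⟨q, hq1, hq2⟩ := ENNReal.lt_iff_exists_nnreal_btwn.1 hr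
  have hq2' : q < 1 := by exact_mod_cast hq2
  have hev := (spectrum.pow_nnnorm_pow_one_div_tendsto_nhds_spectralRadius T).eventually
    (eventually_lt_nhds hq1)
  have hbound : ∀ᶠ j : ℕ in atTop, ‖T ^ j * M * Tᴴ ^ j‖ ≤ ((q : ℝ) ^ 2) ^ j * ‖M‖ := by
    filter_upwards [hev, eventually_gt_atTop 0] with j hj hj0
    have h1 : (‖T ^ j‖₊ : ENNReal) ≤ (q : ENNReal) ^ j := by
      have h2 := ENNReal.rpow_le_rpow hj.le (Nat.cast_nonneg j : (0 : ℝ) ≤ j)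
      rwa [← ENNReal.rpow_mul, one_div, inv_mul_cancel₀ (by exact_mod_cast hj0.ne'),
        ENNReal.rpow_one, ENNReal.rpow_natCast] at h2
    have h2 : ‖T ^ j‖ ≤ (q : ℝ) ^ j := by exact_mod_cast h1
    have h3 : ‖Tᴴ ^ j‖ ≤ (q : ℝ) ^ j := by
      rw [← conjTranspose_pow, Matrix.l2_opNorm_conjTranspose]; exact h2
    calc ‖T ^ j * M * Tᴴ ^ j‖ ≤ ‖T ^ j‖ * ‖M‖ * ‖Tᴴ ^ j‖ :=
          (norm_mul_le _ _).trans (by gcongr; exact norm_mul_le _ _)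
      _ ≤ (q : ℝ) ^ j * ‖M‖ * (q : ℝ) ^ j := by gcongr
      _ = _ := by ring
  refine Summable.of_norm_bounded_eventually_nat ?_ hbound
  refine (summable_geometric_of_lt_one (by positivity) ?_).mul_right _
  have : (q : ℝ) < 1 := by exact_mod_cast hq2'
  nlinarith [q.2]

end

lemma norm_lt_one_of_mem_spectrum_matT {n : Fin k → ℕ} {z : Fin k → ℂ}
    (hz : ∀ i, z i ∈ ball (0 : ℂ) 1) : ∀ μ ∈ spectrum ℂ (matT n z), ‖μ‖ < 1 := by
  intro μ hμ
  rw [spectrum.mem_iff, Matrix.isUnit_iff_isUnit_det, Algebra.algebraMap_eq_smul_one,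
    ← one_smul ℂ (matT n z), det_smul_one_sub_matT, isUnit_iff_ne_zero, not_not] at hμ
  obtain ⟨i, -, hi⟩ := Finset.prod_eq_zero_iff.1 hμ
  have h1 := eq_zero_of_pow_eq_zero hi
  rw [one_mul, sub_eq_zero] at h1
  rw [h1]
  exact mem_ball_zero_iff.1 (hz i)

theorem isSteinData_pickMatrix {n : Fin k → ℕ} {z : Fin k → ℂ} (f : ∀ i, Fin (n i) → ℂ)
    (hz : ∀ i, z i ∈ ball (0 : ℂ) 1) (hP : IsUnit (pickMatrix n z f)) :
    IsSteinData (matT n z) (pickMatrix n z f) (vecE n) (vecC n f) where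
  isHermitian := by
    rw [Matrix.IsHermitian, pickMatrix, conjTranspose_tsum]
    refine tsum_congr fun j => ?_
    simp [conjTranspose_mul, conjTranspose_pow, conjTranspose_vecMulVec, Matrix.mul_assoc]
  isUnit_det := (isUnit_iff_isUnit_det _).1 hP
  stein := by
    have hsum := summable_pow_mul_mul_conjTranspose_pow (norm_lt_one_of_mem_spectrum_matT (n := n)
      hz)
      (vecMulVec (vecE n) (star (vecE n)) - vecMulVec (vecC n f) (star (vecC n f)))
    have h1 : pickMatrix n z f = _ := hsum.tsum_eq_zero_add
    have h2 : matT n z * pickMatrix n z f * (matT n z)ᴴ = ∑' j : ℕ, matT n z ^ (j + 1) *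
      (vecMulVec (vecE n) (star (vecE n)) - vecMulVec (vecC n f) (star (vecC n f))) *
      (matT n z)ᴴ ^ (j + 1) := by
      rw [pickMatrix, ← hsum.tsum_mul_left, ← (hsum.mul_left _).tsum_mul_right]
      refine tsum_congr fun j => ?_
      rw [pow_succ', pow_succ]
      simp only [Matrix.mul_assoc]
    rw [h2, h1]
    simp
  isUnit_disk := fun _ hw => isUnit_det_one_sub_smul_matT hz hw

/-! ### Interpolation and common zeros -/

/-- The Taylor polynomial of the interpolation data at `z j`. -/
noncomputable def taylorPoly (n : Fin k → ℕ) (z : Fin k → ℂ) (f : ∀ i, Fin (n i) → ℂ) (j : Fin k)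
    (w : ℂ) : ℂ :=
  ∑ a : Fin (n j), (w - z j) ^ (a : ℕ) * f j a

/-- The row vector with the entries `(w - z j) ^ a` in the block `j`; up to a power of `w - z j` it
is the last row of that block of `(w - T)⁻¹`. -/
noncomputable def blockRow (n : Fin k → ℕ) (z : Fin k → ℂ) (j : Fin k) (w : ℂ) :
    (Σ i, Fin (n i)) → ℂ :=
  fun p => if p.1 = j then (w - z j) ^ (p.2 : ℕ) else 0

lemma sum_blockRow_mul (n : Fin k → ℕ) (z : Fin k → ℂ) (j : Fin k) (w : ℂ)
    (x : (Σ i, Fin (n i)) → ℂ) :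
    blockRow n z j w ⬝ᵥ x = ∑ a : Fin (n j), (w - z j) ^ (a : ℕ) * x ⟨j, a⟩ := by
  rw [dotProduct, Fintype.sum_sigma, Finset.sum_eq_single j]
  · simp [blockRow]
  · intro i _ hi
    simp [blockRow, hi]
  · simp

lemma blockRow_vecMul (n : Fin k → ℕ) (z : Fin k → ℂ) (j : Fin k) (w : ℂ) :
    blockRow n z j w ᵥ* (w • (1 : Matrix (Σ i, Fin (n i)) (Σ i, Fin (n i)) ℂ) - matT n z) =
      (w - z j) ^ n j • fun q : Σ i, Fin (n i) =>
        if q.1 = j ∧ (q.2 : ℕ) + 1 = n j then (1 : ℂ) else 0 := by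
  ext ⟨i, b⟩
  rw [vecMul, sum_blockRow_mul]
  by_cases hij : i = j
  · subst hij
    have h1 : ∀ a : Fin (n i), (w - z i) ^ (a : ℕ) *
        (w • (1 : Matrix (Σ i, Fin (n i)) (Σ i, Fin (n i)) ℂ) - matT n z) ⟨i, a⟩ ⟨i, b⟩ =
        (if a = b then (w - z i) ^ ((b : ℕ) + 1) else 0) -
          (if (a : ℕ) = (b : ℕ) + 1 then (w - z i) ^ ((b : ℕ) + 1) else 0) := by
      intro a
      rw [Matrix.sub_apply, Matrix.smul_apply, matT, blockDiagonal'_apply_eq, jordanBlock,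
        Matrix.one_apply, Matrix.of_apply, smul_eq_mul]
      by_cases hab : a = b
      · subst hab
        simp [pow_succ]
      · by_cases hab' : (a : ℕ) = (b : ℕ) + 1
        · simp [hab, hab']
        · simp [hab, hab']
    simp only [h1]
    rw [Finset.sum_sub_distrib, Finset.sum_ite_eq' Finset.univ b]
    simp only [Finset.mem_univ, if_true, true_and, Pi.smul_apply, smul_eq_mul]
    by_cases hb : (b : ℕ) + 1 = n i
    · rw [Finset.sum_eq_zero fun a _ => if_neg (by omega)]
      simp [hb]
    · have hb' : (b : ℕ) + 1 < n i := by omega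
      rw [Finset.sum_eq_single (⟨(b : ℕ) + 1, hb'⟩ : Fin (n i))]
      · simp [hb]
      · intro a _ ha
        exact if_neg fun h => ha (Fin.ext h)
      · simp
  · have h1 : ∀ a : Fin (n j),
        (w • (1 : Matrix (Σ i, Fin (n i)) (Σ i, Fin (n i)) ℂ) - matT n z) ⟨j, a⟩ ⟨i, b⟩ = 0 := by
      intro a
      rw [Matrix.sub_apply, Matrix.smul_apply, matT, blockDiagonal'_apply_ne _ _ _ (Ne.symm hij),
        Matrix.one_apply_ne (fun h => hij (congrArg Sigma.fst h).symm)]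
      simp
    simp [h1, hij]

/-- The interpolation conditions: `Θ₁ₗ - F Θ₂ₗ` vanishes at `z j` to order at least `n j`, where
`F` is the Taylor polynomial of the data. -/
lemma exists_thetaMat_sub {n : Fin k → ℕ} {z : Fin k → ℂ} {f : ∀ i, Fin (n i) → ℂ}
    {P : Matrix (Σ i, Fin (n i)) (Σ i, Fin (n i)) ℂ}
    (h : IsSteinData (matT n z) P (vecE n) (vecC n f)) (j : Fin k) (hj : 0 < n j) (l : Fin 2) :
    ∃ g : ℂ → ℂ, DifferentiableOn ℂ g (ball 0 1) ∧ ∀ w ∈ ball (0 : ℂ) 1,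
      thetaMat (matT n z) P (vecE n) (vecC n f) w 0 l -
        taylorPoly n z f j w * thetaMat (matT n z) P (vecE n) (vecC n f) w 1 l =
      (w - z j) ^ n j * g w := by
  set T := matT n z
  set L := cols (vecE n) (-vecC n f)
  set H : ℂ → Matrix (Σ i, Fin (n i)) (Fin 2) ℂ := fun w =>
    (1 - T)⁻¹ * L + (w - 1) • (P * Tᴴ * (1 - w • Tᴴ)⁻¹ * (P⁻¹ * (1 - T)⁻¹ * L)) with hH
  have hHd : ∀ w ∈ ball (0 : ℂ) 1, ∀ p l, DifferentiableAt ℂ (fun w => H w p l) w := by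
    intro w hw p l
    simp only [hH, Matrix.add_apply, Matrix.smul_apply, smul_eq_mul]
    refine (differentiableAt_const _).add (DifferentiableAt.mul (by fun_prop) ?_)
    refine differentiableAt_mul (N := fun _ => P⁻¹ * (1 - T)⁻¹ * L) (fun a b => ?_)
      (fun a b => differentiableAt_const _) p l
    exact differentiableAt_mul (M := fun _ => P * Tᴴ) (fun a b => differentiableAt_const _)
      (h.differentiableAt_resolvent (mem_ball_zero_iff.1 hw).le) a b
  set e : (Σ i, Fin (n i)) → ℂ := fun q =>
    if q.1 = j ∧ (q.2 : ℕ) + 1 = n j then (1 : ℂ) else 0 with he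
  refine ⟨fun w => (e ᵥ* H w) l, fun w hw => ?_, fun w hw => ?_⟩
  · refine DifferentiableAt.differentiableWithinAt ?_
    simp only [vecMul, dotProduct]
    exact DifferentiableAt.fun_sum fun p _ => (hHd w hw p l).const_mul _
  · have h1 := congrArg (fun M => (blockRow n z j w ᵥ* M) l)
      (h.cols_mul_thetaMat (mem_ball_zero_iff.1 hw).le)
    simp only [← vecMul_vecMul] at h1
    rw [blockRow_vecMul, smul_vecMul, Pi.smul_apply, smul_eq_mul] at h1
    rw [← h1, vecMul, dotProduct, Fin.sum_univ_two]
    have h2 : (blockRow n z j w ᵥ* cols (vecE n) (-vecC n f)) 0 = 1 := by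
      rw [vecMul, sum_blockRow_mul, Finset.sum_eq_single (⟨0, hj⟩ : Fin (n j))]
      · simp [cols, vecE]
      · intro a _ ha
        have : (a : ℕ) ≠ 0 := fun h => ha (Fin.ext h)
        simp [cols, vecE, this]
      · simp
    have h3 : (blockRow n z j w ᵥ* cols (vecE n) (-vecC n f)) 1 = -taylorPoly n z f j w := by
      rw [vecMul, sum_blockRow_mul, taylorPoly, ← Finset.sum_neg_distrib]
      refine Finset.sum_congr rfl fun a _ => ?_
      simp [cols, vecC]
    rw [h2, h3]
    ring

section

variable {n : Fin k → ℕ} {z : Fin k → ℂ} {f : ∀ i, Fin (n i) → ℂ}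
  {P : Matrix (Σ i, Fin (n i)) (Σ i, Fin (n i)) ℂ} {U V S B : ℂ → ℂ}

lemma analyticOrderAt_sub_pow (a : ℂ) (m : ℕ) :
    analyticOrderAt (fun w : ℂ => (w - a) ^ m) a = m := by
  simpa [Pi.pow_def, Pi.sub_def] using
    analyticOrderAt_centeredMonomial (𝕜 := ℂ) (z₀ := a) (n := m)

/-- `U` is congruent to `F V` modulo `(w - z j) ^ n j`. -/
lemma min_le_analyticOrderAt (h : IsSteinData (matT n z) P (vecE n) (vecC n f))
    (hz : ∀ i, z i ∈ ball (0 : ℂ) 1) {j : Fin k} (hS : IsSchur S) (hB : IsSchur B)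
    (hU : ∀ w, U w = thetaMat (matT n z) P (vecE n) (vecC n f) w 0 0 * S w +
      thetaMat (matT n z) P (vecE n) (vecC n f) w 0 1 * B w)
    (hV : ∀ w, V w = thetaMat (matT n z) P (vecE n) (vecC n f) w 1 0 * S w +
      thetaMat (matT n z) P (vecE n) (vecC n f) w 1 1 * B w) (hVa : AnalyticAt ℂ V (z j)) :
    min (n j : ℕ∞) (analyticOrderAt V (z j)) ≤ analyticOrderAt U (z j) := by
  rcases Nat.eq_zero_or_pos (n j) with h0 | hj
  · simp [h0]
  obtain ⟨g₀, hg₀, he₀⟩ := exists_thetaMat_sub h j hj 0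
  obtain ⟨g₁, hg₁, he₁⟩ := exists_thetaMat_sub h j hj 1
  have hnhds : ball (0 : ℂ) 1 ∈ 𝓝 (z j) := isOpen_ball.mem_nhds (hz j)
  have hF : AnalyticAt ℂ (taylorPoly n z f j) (z j) := by
    refine Differentiable.analyticAt (f := taylorPoly n z f j) ?_ _
    unfold taylorPoly
    fun_prop
  have hG : AnalyticAt ℂ (fun w => g₀ w * S w + g₁ w * B w) (z j) :=
    ((hg₀.analyticAt hnhds).mul (hS.1 _ (hz j))).add ((hg₁.analyticAt hnhds).mul (hB.1 _ (hz j)))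
  have hpow : AnalyticAt ℂ (fun w : ℂ => (w - z j) ^ n j) (z j) := by fun_prop
  have hUV : U =ᶠ[𝓝 (z j)] taylorPoly n z f j * V +
      (fun w : ℂ => (w - z j) ^ n j) * fun w => g₀ w * S w + g₁ w * B w := by
    filter_upwards [hnhds] with w hw
    simp only [Pi.add_apply, Pi.mul_apply]
    rw [hU, hV]
    linear_combination S w * he₀ w hw + B w * he₁ w hw
  rw [analyticOrderAt_congr hUV]
  refine le_trans ?_ le_analyticOrderAt_add
  rw [analyticOrderAt_mul hF hVa, analyticOrderAt_mul hpow hG, min_comm]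
  rw [analyticOrderAt_sub_pow]
  exact min_le_min le_add_self le_self_add

/-- `det Θ` vanishes in the disk exactly at the points `z j`, to the order `n j`. -/
lemma det_thetaMat_eq (h : IsSteinData (matT n z) P (vecE n) (vecC n f)) :
    ∃ g : ℂ → ℂ, DifferentiableOn ℂ g (ball 0 1) ∧ (∀ w ∈ ball (0 : ℂ) 1, g w ≠ 0) ∧
      ∀ w ∈ ball (0 : ℂ) 1, (thetaMat (matT n z) P (vecE n) (vecC n f) w).det =
        (∏ i, (w - z i) ^ n i) * g w := by
  have hD : ∀ w ∈ ball (0 : ℂ) 1, (1 - w • (matT n z)ᴴ).det ≠ 0 := fun w hw =>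
    (h.isUnit_disk w (mem_ball_zero_iff.1 hw).le).ne_zero
  have hR := h.isUnit_det_one_sub.ne_zero
  refine ⟨fun w => (1 - (matT n z)ᴴ).det / ((1 - matT n z).det * (1 - w • (matT n z)ᴴ).det),
    fun w hw => ?_, fun w hw => ?_, fun w hw => ?_⟩
  · refine DifferentiableAt.differentiableWithinAt (DifferentiableAt.div (by fun_prop) ?_
      (mul_ne_zero hR (hD w hw)))
    refine (differentiableAt_const _).mul (differentiableAt_det fun a b => ?_)
    simp only [Matrix.sub_apply, Matrix.smul_apply, smul_eq_mul]
    fun_prop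
  · exact div_ne_zero h.isUnit_det_one_sub_conjTranspose.ne_zero (mul_ne_zero hR (hD w hw))
  · have h1 := h.det_thetaMat (mem_ball_zero_iff.1 hw).le
    have h2 := det_smul_one_sub_matT n z w 1
    simp only [one_smul, one_mul] at h2
    rw [h2] at h1
    have h3 := hD w hw
    field_simp
    linear_combination h1

end

end

section

variable {k : ℕ} {n : Fin k → ℕ} {z : Fin k → ℂ} {f : ∀ i, Fin (n i) → ℂ}
  {P : Matrix (Σ i, Fin (n i)) (Σ i, Fin (n i)) ℂ} {U V S B : ℂ → ℂ}

/-- If `U` and `V` vanish at `z j` to an order above `n j`, then so does the product of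
`det Θ` with a function `R` for which `(det Θ) R` is a combination of `U` and `V`; hence `R`
vanishes at `z j`. -/
lemma eq_zero_of_lt_analyticOrderAt (h : IsSteinData (matT n z) P (vecE n) (vecC n f))
    (hz : ∀ i, z i ∈ ball (0 : ℂ) 1) (hinj : Function.Injective z) {j : Fin k}
    {R a b : ℂ → ℂ} (hR : AnalyticAt ℂ R (z j)) (ha : AnalyticAt ℂ a (z j))
    (hb : AnalyticAt ℂ b (z j)) (hUa : AnalyticAt ℂ U (z j)) (hVa : AnalyticAt ℂ V (z j))
    (heq : ∀ w, (thetaMat (matT n z) P (vecE n) (vecC n f) w).det * R w = a w * U w + b w * V w)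
    (hord : (n j : ℕ∞) < min (analyticOrderAt U (z j)) (analyticOrderAt V (z j))) :
    R (z j) = 0 := by
  obtain ⟨g, hg, hg0, hdet⟩ := det_thetaMat_eq h
  have hnhds : ball (0 : ℂ) 1 ∈ 𝓝 (z j) := isOpen_ball.mem_nhds (hz j)
  set q : ℂ → ℂ := fun w => (∏ i ∈ Finset.univ.erase j, (w - z i) ^ n i) * g w with hq
  have hpd : Differentiable ℂ fun w => ∏ i ∈ Finset.univ.erase j, (w - z i) ^ n i := by fun_prop
  have hqa : AnalyticAt ℂ q (z j) := (hpd.analyticAt _).mul (hg.analyticAt hnhds)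
  have hq0 : q (z j) ≠ 0 := mul_ne_zero (Finset.prod_ne_zero_iff.2 fun i hi => pow_ne_zero _
    (sub_ne_zero.2 fun h => (Finset.ne_of_mem_erase hi) (hinj h).symm)) (hg0 _ (hz j))
  have hpow : AnalyticAt ℂ (fun w : ℂ => (w - z j) ^ n j) (z j) := by fun_prop
  have hE : a * U + b * V =ᶠ[𝓝 (z j)] (fun w : ℂ => (w - z j) ^ n j) * (q * R) := by
    filter_upwards [hnhds] with w hw
    simp only [Pi.add_apply, Pi.mul_apply, hq]
    rw [← heq, hdet w hw, ← Finset.mul_prod_erase Finset.univ _ (Finset.mem_univ j)]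
    ring
  have h1 : min (analyticOrderAt U (z j)) (analyticOrderAt V (z j)) ≤
      analyticOrderAt (a * U + b * V) (z j) := by
    refine le_trans ?_ le_analyticOrderAt_add
    rw [analyticOrderAt_mul ha hUa, analyticOrderAt_mul hb hVa]
    exact min_le_min le_add_self le_add_self
  have h2 : analyticOrderAt (fun w : ℂ => (w - z j) ^ n j) (z j) = n j :=
    analyticOrderAt_sub_pow _ _
  rw [analyticOrderAt_congr hE, analyticOrderAt_mul hpow (hqa.mul hR), h2,
    analyticOrderAt_mul hqa hR, (hqa.analyticOrderAt_eq_zero).2 hq0, zero_add] at h1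
  refine apply_eq_zero_of_analyticOrderAt_ne_zero fun h0 => ?_
  rw [h0, add_zero] at h1
  exact absurd (hord.trans_le h1) (lt_irrefl _)

end

end MultiPoint

open MultiPoint in
theorem theorem2p3 (k : ℕ) (n : Fin k → ℕ) (z : Fin k → ℂ) (f : ∀ i, Fin (n i) → ℂ)
    (hz : ∀ i, z i ∈ Metric.ball (0 : ℂ) 1) (hinj : Function.Injective z)
    (hP : IsUnit (MultiPoint.pickMatrix n z f))
    (κ : ℕ) (S B : ℂ → ℂ) (hS : MultiPoint.IsSchur S) (hB : MultiPoint.IsBlaschke κ B) :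
    -- the zero counts
    MultiPoint.numZeros (MultiPoint.denV n z f S B) =
      ((MultiPoint.sqNeg (MultiPoint.pickMatrix n z f) + κ : ℕ) : ℕ∞) ∧
    (∀ m : ℕ, MultiPoint.IsBlaschke m S →
      MultiPoint.numZeros (MultiPoint.numU n z f S B) =
        ((MultiPoint.sqPos (MultiPoint.pickMatrix n z f) + m : ℕ) : ℕ∞)) ∧
    -- common zeros, for `S` and `B` without common zeros in the disk
    ((∀ w ∈ Metric.ball (0 : ℂ) 1, ¬ (S w = 0 ∧ B w = 0)) →
      (∀ w ∈ Metric.ball (0 : ℂ) 1, MultiPoint.numU n z f S B w = 0 →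
        MultiPoint.denV n z f S B w = 0 → ∃ j, w = z j) ∧
      (∀ j, min (analyticOrderAt (MultiPoint.numU n z f S B) (z j))
        (analyticOrderAt (MultiPoint.denV n z f S B) (z j)) ≤ (n j : ℕ∞)) ∧
      (∀ j, (n j : ℕ∞) < analyticOrderAt (MultiPoint.denV n z f S B) (z j) →
        analyticOrderAt (MultiPoint.numU n z f S B) (z j) = (n j : ℕ∞))) ∧
    -- vanishing of the denominator of order at most `n j` forces that of the numerator
    (∀ j, analyticOrderAt (MultiPoint.denV n z f S B) (z j) ≤ (n j : ℕ∞) →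
      analyticOrderAt (MultiPoint.denV n z f S B) (z j) ≤
        analyticOrderAt (MultiPoint.numU n z f S B) (z j)) := by
  have h := isSteinData_pickMatrix f hz hP
  have hB' := hB.isSchur
  set Θ := thetaMat (matT n z) (pickMatrix n z f) (vecE n) (vecC n f) with hΘ
  set U := numU n z f S B
  set V := denV n z f S B
  have hU : ∀ w, U w = Θ w 0 0 * S w + Θ w 0 1 * B w := fun w => rfl
  have hV : ∀ w, V w = Θ w 1 0 * S w + Θ w 1 1 * B w := fun w => rfl
  have hΘa : ∀ i l, ∀ w ∈ Metric.ball (0 : ℂ) 1, AnalyticAt ℂ (fun w => Θ w i l) w :=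
    fun i l w hw => DifferentiableOn.analyticAt (s := Metric.ball (0 : ℂ) 1)
      (fun v hv => (h.differentiableAt_thetaMat (mem_ball_zero_iff.1 hv).le i
        l).differentiableWithinAt) (Metric.isOpen_ball.mem_nhds hw)
  have hUa : ∀ w ∈ Metric.ball (0 : ℂ) 1, AnalyticAt ℂ U w := fun w hw =>
    ((hΘa 0 0 w hw).mul (hS.1 w hw)).add ((hΘa 0 1 w hw).mul (hB'.1 w hw))
  have hVa : ∀ w ∈ Metric.ball (0 : ℂ) 1, AnalyticAt ℂ V w := fun w hw =>
    ((hΘa 1 0 w hw).mul (hS.1 w hw)).add ((hΘa 1 1 w hw).mul (hB'.1 w hw))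
  -- Cramer's rule: `adj Θ` recovers `S` and `B`, up to the factor `det Θ`
  have hcS : ∀ w, (Θ w).det * S w = Θ w 1 1 * U w + -Θ w 0 1 * V w := fun w => by
    rw [hU, hV, Matrix.det_fin_two]; ring
  have hcB : ∀ w, (Θ w).det * B w = -Θ w 1 0 * U w + Θ w 0 0 * V w := fun w => by
    rw [hU, hV, Matrix.det_fin_two]; ring
  have hmin : ∀ j, min (n j : ℕ∞) (analyticOrderAt V (z j)) ≤ analyticOrderAt U (z j) := fun j =>
    min_le_analyticOrderAt h hz hS hB' hU hV (hVa _ (hz j))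
  have hcommon : (∀ w ∈ Metric.ball (0 : ℂ) 1, ¬ (S w = 0 ∧ B w = 0)) →
      ∀ j, min (analyticOrderAt U (z j)) (analyticOrderAt V (z j)) ≤ (n j : ℕ∞) := by
    intro hSB j
    by_contra hlt
    rw [not_le] at hlt
    exact hSB _ (hz j)
      ⟨eq_zero_of_lt_analyticOrderAt h hz hinj (hS.1 _ (hz j)) (hΘa 1 1 _ (hz j))
        (hΘa 0 1 _ (hz j)).neg (hUa _ (hz j)) (hVa _ (hz j)) hcS hlt,
      eq_zero_of_lt_analyticOrderAt h hz hinj (hB'.1 _ (hz j)) (hΘa 1 0 _ (hz j)).neg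
        (hΘa 0 0 _ (hz j)) (hUa _ (hz j)) (hVa _ (hz j)) hcB hlt⟩
  refine ⟨h.numZeros_denominator hS hB, fun m hm => h.numZeros_numerator hm hB',
    fun hSB => ⟨fun w hw hU0 hV0 => ?_, hcommon hSB, fun j hj => ?_⟩, fun j hj => ?_⟩
  · by_contra hne
    obtain ⟨g, -, hg0, hdet⟩ := det_thetaMat_eq h
    have hdet0 : (Θ w).det ≠ 0 := by
      rw [hΘ, hdet w hw]
      exact mul_ne_zero (Finset.prod_ne_zero_iff.2 fun i _ => pow_ne_zero _
        (sub_ne_zero.2 fun h => hne ⟨i, h⟩)) (hg0 w hw)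
    refine hSB w hw ⟨?_, ?_⟩
    · simpa [hU0, hV0, hdet0] using hcS w
    · simpa [hU0, hV0, hdet0] using hcB w
  · have h1 := hmin j
    have h2 := hcommon hSB j
    rw [min_eq_left hj.le] at h1
    refine le_antisymm ?_ h1
    rcases min_le_iff.1 h2 with h2 | h2
    · exact h2
    · exact absurd hj (not_lt.2 h2)
  · have h1 := hmin j
    rwa [min_eq_right hj] at h1
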